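/- There are universal constants $c, C > 0$ such that the following holds. Let $n \ge 2$ and let $(b_{ij})_{1\le i,j\le n}$ be real numbers with $b_{ij} = b_{ji} \ge 0$. Let $(g_{ij})_{i \le j}$ be independent standard Gaussian random variables, put $g_{ji} = g_{ij}$, and let $X$ be the $n \times n$ symmetric random matrix with entries $X_{ij} = b_{ij} g_{ij}$. Let $\|X\|$ denote the spectral norm (largest singular value) of $X$, and let $\log$ be the natural logarithm. Then $\mathbf{E}[\|X\|^{\log n}] < \infty$ and $$ c\left( \max_{i\le n} \sqrt{\sum_{j=1}^n b_{ij}^2} + \max_{i,j\le n} b_{ij}\,\sqrt{\log n} \right) \le \mathbf{E}\big[\|X\|^{\log n}\big]^{1/\log n} \le C\left( \max_{i\le n} \sqrt{\sum_{j=1}^n b_{ij}^2} + \max_{i,j\le n} b_{ij}\,\sqrt{\log n} \right). $$ -/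

import Mathlib

open MeasureTheory ProbabilityTheory

noncomputable section

/-- The spectral norm of a real square matrix: its largest singular value. Mathlib lists the
singular values in decreasing order, starting at index `0`. -/
def matrixSpectralNorm {n : ℕ} (A : Matrix (Fin n) (Fin n) ℝ) : ℝ :=
  (Matrix.toEuclideanLin A).singularValues 0

/-- The spectral norm is the operator norm with respect to the Euclidean norm. -/
theorem matrixSpectralNorm_eq_opNorm {n : ℕ} (hn : 0 < n) (A : Matrix (Fin n) (Fin n) ℝ) :
    matrixSpectralNorm A = ‖Matrix.toEuclideanCLM (n := Fin n) (𝕜 := ℝ) A‖ := by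
  have hfin : Module.finrank ℝ (EuclideanSpace ℝ (Fin n)) = n := by simp
  set T := Matrix.toEuclideanLin A with hT
  have hTA : ∀ x, Matrix.toEuclideanCLM (n := Fin n) (𝕜 := ℝ) A x = T x := fun x => rfl
  set hS := T.isSymmetric_adjoint_comp_self with hSdef
  set e := hS.eigenvectorBasis hfin
  set l := hS.eigenvalues hfin with hl
  have h0 : matrixSpectralNorm A = √(l ⟨0, hn⟩) := T.singularValues_of_lt hfin hn
  have hnn : ∀ i, 0 ≤ l i := T.isPositive_adjoint_comp_self.nonneg_eigenvalues hfin
  have key : ∀ x, ‖T x‖ ^ 2 = ∑ i, l i * (e.repr x i) ^ 2 := by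
    intro x
    have h1 : ‖T x‖ ^ 2 = inner ℝ ((LinearMap.adjoint T ∘ₗ T) x) x := by
      rw [LinearMap.comp_apply, LinearMap.adjoint_inner_left, real_inner_self_eq_norm_sq]
    rw [h1, ← e.repr.inner_map_map, PiLp.inner_apply]
    refine Finset.sum_congr rfl fun i _ => ?_
    have h2 := hS.eigenvectorBasis_apply_self_apply hfin x i
    simp only [e, l] at h2 ⊢
    rw [h2]
    simp only [RCLike.ofReal_real_eq_id, id_eq, RCLike.inner_apply, conj_trivial]
    ring
  rw [h0]
  apply le_antisymm
  · have h3 : ‖T (e ⟨0, hn⟩)‖ ^ 2 = l ⟨0, hn⟩ := by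
      rw [key]
      simp [e.repr_self]
    rw [← h3, Real.sqrt_sq (norm_nonneg _), ← hTA]
    exact (ContinuousLinearMap.le_opNorm _ _).trans (by simp [e.norm_eq_one])
  · refine ContinuousLinearMap.opNorm_le_bound _ (Real.sqrt_nonneg _) fun x => ?_
    rw [hTA]
    refine abs_le_of_sq_le_sq' ?_ (by positivity) |>.2
    rw [key, mul_pow, Real.sq_sqrt (hnn _), ← e.repr.norm_map x, EuclideanSpace.norm_sq_eq,
      Finset.mul_sum]
    refine Finset.sum_le_sum fun i _ => ?_
    rw [Real.norm_eq_abs, sq_abs]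
    exact mul_le_mul_of_nonneg_right
      (hS.eigenvalues_antitone hfin (Fin.mk_le_of_le_val (Nat.zero_le _))) (sq_nonneg _)

/-- `g` is a symmetric array of standard Gaussian random variables `g i j = g j i` whose entries
on and above the diagonal are independent. -/
structure IsSymmetricGaussianArray {Ω : Type*} [MeasurableSpace Ω] {n : ℕ}
    (g : Fin n → Fin n → Ω → ℝ) (P : Measure Ω) : Prop where
  symm : ∀ i j, g i j = g j i
  law : ∀ i j, HasLaw (g i j) (gaussianReal 0 1) P
  indep : iIndepFun (fun p : {p : Fin n × Fin n // p.1 ≤ p.2} => g p.1.1 p.1.2) P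

/-- The random matrix with entries `X i j = b i j * g i j`. -/
def structuredMatrix {Ω : Type*} {n : ℕ} (b : Fin n → Fin n → ℝ) (g : Fin n → Fin n → Ω → ℝ)
    (ω : Ω) : Matrix (Fin n) (Fin n) ℝ :=
  Matrix.of fun i j => b i j * g i j ω

/-- The maximal Euclidean norm of a row, `max_i (∑_j b_ij²)^{1/2}` (for `n ≥ 1`). -/
def maxRowNorm {n : ℕ} (b : Fin n → Fin n → ℝ) : ℝ :=
  ⨆ i, √(∑ j, b i j ^ 2)

/-- The maximal entry `max_{i,j} b_ij` (for `n ≥ 1`). -/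
def maxEntry {n : ℕ} (b : Fin n → Fin n → ℝ) : ℝ :=
  ⨆ p : Fin n × Fin n, b p.1 p.2

end

noncomputable section

open Finset

open scoped Matrix.Norms.L2Operator

/-! The upper bound compares dimensions. Rescale so that `maxEntry b` is 1 and take p at least both
the largest squared row norm and log n. Expand E tr X^(2p) over closed walks and group the walks by
coincidence pattern. As odd Gaussian moments vanish, a contributing pattern crosses every edge at
least twice, so it has m ≤ p steps to new vertices. Pairing these steps with repetitions of their
edges bounds the weighted count on n vertices by n p^m (`sum_samePattern_le`). On 2p vertices at
least 2p · p^m unweighted walks have the pattern (`mul_pow_le_card_samePattern`). All Gaussian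
moments being nonnegative, this gives 2p · E tr X^(2p) ≤ n · E tr Y^(2p), where Y is an unweighted
2p × 2p Gaussian matrix (`mul_sum_closed_walks_le`).

A net argument gives E‖Y‖^(2p) ≤ (C p)^p (`integral_norm_pow_le`). The factor n costs only a
constant in the root, because n ≤ e^p. Undoing the scaling, the root is of order `maxEntry b` · √p,
which is the claimed sum; one then passes from the exponent 2p down to log n.

For the lower bound the norm dominates each entry and each row. A single Gaussian exceeds √q with
probability of order at least e^(-q) (`entry_mul_sqrt_le`), and a row is comparable to its expected
size with probability bounded below (`sqrt_sum_sq_row_le`). -/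

/-! ### Mixed moments and repeated colours -/

/-- The product over the colours `a` of `γ m`, where `m` is the number of indices of colour `a`. -/
def mixedMoment {ι α : Type*} [Fintype ι] [Fintype α] [DecidableEq α] (γ : ℕ → ℝ) (e : ι → α) : ℝ :=
  ∏ a, γ #{k | e k = a}

theorem mixedMoment_eq_prod_image {ι α : Type*} [Fintype ι] [Fintype α] [DecidableEq α]
    {γ : ℕ → ℝ} (h0 : γ 0 = 1) (e : ι → α) :
    mixedMoment γ e = ∏ a ∈ univ.image e, γ #{k | e k = a} := by
  refine (prod_subset (subset_univ _) fun a _ ha => ?_).symm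
  rw [filter_eq_empty_iff.2, card_empty, h0]
  intro k _ hk
  exact ha (mem_image.2 ⟨k, mem_univ k, hk⟩)

/-- Unused colours contribute γ 0 = 1, so only the partition into colour classes matters. This lets
walks on vertex sets of different sizes be compared. -/
theorem mixedMoment_congr {ι α β : Type*} [Fintype ι] [Fintype α] [DecidableEq α]
    [Fintype β] [DecidableEq β] {γ : ℕ → ℝ} (h0 : γ 0 = 1) {e : ι → α} {e' : ι → β}
    (h : ∀ k l, e k = e l ↔ e' k = e' l) : mixedMoment γ e = mixedMoment γ e' := by
  rw [mixedMoment_eq_prod_image h0, mixedMoment_eq_prod_image h0]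
  have hc : ∀ a ∈ univ.image e, ∃ k, e k = a := by simp
  refine prod_bij (fun a ha => e' (hc a ha).choose) (fun a ha => mem_image_of_mem _ (mem_univ _))
    (fun a ha a' ha' heq => ?_) (fun c hcm => ?_) (fun a ha => ?_)
  · rw [← (hc a ha).choose_spec, ← (hc a' ha').choose_spec]
    exact (h _ _).2 heq
  · obtain ⟨k, -, rfl⟩ := mem_image.1 hcm
    have hk : e k ∈ univ.image e := mem_image_of_mem _ (mem_univ _)
    exact ⟨e k, hk, (h _ _).1 (hc _ hk).choose_spec⟩
  · congr 2
    ext k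
    simp only [mem_filter, mem_univ, true_and]
    rw [← h, (hc a ha).choose_spec]

theorem mixedMoment_nonneg {ι α : Type*} [Fintype ι] [Fintype α] [DecidableEq α] {γ : ℕ → ℝ}
    (h : ∀ m, 0 ≤ γ m) (e : ι → α) : 0 ≤ mixedMoment γ e :=
  prod_nonneg fun _ _ => h _

theorem exists_ne_of_mixedMoment_ne_zero {ι α : Type*} [Fintype ι] [Fintype α] [DecidableEq α]
    {γ : ℕ → ℝ} (h1 : γ 1 = 0) {e : ι → α} (he : mixedMoment γ e ≠ 0) (k : ι) :
    ∃ l, l ≠ k ∧ e l = e k := by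
  by_contra! hne
  refine he (prod_eq_zero (mem_univ (e k)) ?_)
  rw [card_eq_one.2 ⟨k, ?_⟩, h1]
  ext l
  simp only [mem_filter, mem_univ, true_and, mem_singleton]
  exact ⟨fun hl => by_contra fun hlk => hne l hlk hl, fun hl => hl ▸ rfl⟩

section partner

variable {ι α : Type*} [DecidableEq ι] {e : ι → α} {D : Finset ι} {f : ι → ℝ}

theorem exists_disjoint_partner (hinj : Set.InjOn e D) (hp : ∀ k ∈ D, ∃ l, l ≠ k ∧ e l = e k) :
    ∃ τ : ι → ι, Set.InjOn τ D ∧ Disjoint D (D.image τ) ∧ ∀ k ∈ D, e (τ k) = e k := by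
  choose! τ hne hτ using hp
  refine ⟨τ, fun k hk l hl hkl => hinj hk hl ?_, ?_, hτ⟩
  · rw [← hτ k hk, ← hτ l hl, hkl]
  · rw [disjoint_left]
    intro k hk hk'
    obtain ⟨l, hl, rfl⟩ := mem_image.1 hk'
    exact hne l hl (hinj hk hl (hτ l hl))

theorem two_mul_card_le_of_partner [Fintype ι] (hinj : Set.InjOn e D)
    (hp : ∀ k ∈ D, ∃ l, l ≠ k ∧ e l = e k) : 2 * #D ≤ Fintype.card ι := by
  obtain ⟨τ, hτ, hd, -⟩ := exists_disjoint_partner hinj hp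
  calc 2 * #D = #(D ∪ D.image τ) := by rw [card_union_of_disjoint hd, card_image_of_injOn hτ]; ring
    _ ≤ _ := card_le_univ _

/-- Each index of D has a partner outside D with the same colour, hence the same factor, and
distinct indices have distinct partners; the remaining factors are at most 1. -/
theorem prod_le_prod_sq_of_partner [Fintype ι] (hinj : Set.InjOn e D)
    (hp : ∀ k ∈ D, ∃ l, l ≠ k ∧ e l = e k) (hf0 : ∀ k, 0 ≤ f k) (hf1 : ∀ k, f k ≤ 1)
    (hfe : ∀ k l, e k = e l → f k = f l) : ∏ k, f k ≤ ∏ k ∈ D, f k ^ 2 := by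
  obtain ⟨τ, hτ, hd, he⟩ := exists_disjoint_partner hinj hp
  calc ∏ k, f k ≤ ∏ k ∈ D ∪ D.image τ, f k := by
        rw [← prod_sdiff (subset_univ (D ∪ D.image τ))]
        exact mul_le_of_le_one_left (prod_nonneg fun k _ => hf0 k)
          (prod_le_one (fun k _ => hf0 k) fun k _ => hf1 k)
    _ = ∏ k ∈ D, f k ^ 2 := by
        rw [prod_union hd, prod_image hτ, ← prod_mul_distrib]
        refine prod_congr rfl fun k hk => ?_
        rw [hfe _ _ (he k hk), sq]

end partner

/-! ### Fresh steps and counting walks with a given pattern -/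

/-- The step `k` of the walk `u` leads to a vertex that has not been visited before. -/
def IsFresh {α : Type*} {N : ℕ} (u : Fin (N + 1) → α) (k : Fin N) : Prop :=
  ∀ l : Fin (N + 1), l ≤ k.castSucc → u l ≠ u k.succ

/-- Two walks have the same pattern if they have the same coincidences. -/
def SamePattern {α β : Type*} {N : ℕ} (t : Fin (N + 1) → α) (u : Fin (N + 1) → β) : Prop :=
  ∀ k l, u k = u l ↔ t k = t l

theorem SamePattern.isFresh_iff {α β : Type*} {N : ℕ} {t : Fin (N + 1) → α} {u : Fin (N + 1) → β}
    (h : SamePattern t u) (k : Fin N) : IsFresh u k ↔ IsFresh t k :=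
  forall₂_congr fun _ _ => not_congr (h _ _)

-- A visited vertex is either the starting point or is first reached by a fresh step.
open scoped Classical in
theorem card_image_le_card_fresh {α : Type*} [DecidableEq α] {N : ℕ} (u : Fin (N + 1) → α) :
    #(univ.image u) ≤ #{k | IsFresh u k} + 1 := by
  have hsub : univ.image u ⊆
      insert (u 0) (({k | IsFresh u k} : Finset (Fin N)).image fun k => u k.succ) := by
    intro a ha
    obtain ⟨i, -, rfl⟩ := mem_image.1 ha
    obtain ⟨l, hl, hmin⟩ := exists_min_image ({l | u l = u i} : Finset (Fin (N + 1))) id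
      ⟨i, by simp⟩
    rw [mem_filter] at hl
    rw [← hl.2]
    rcases Fin.eq_zero_or_eq_succ l with rfl | ⟨k, rfl⟩
    · exact mem_insert_self _ _
    · refine mem_insert_of_mem (mem_image.2 ⟨k, ?_, rfl⟩)
      rw [mem_filter]
      refine ⟨mem_univ _, fun m hm hmk => ?_⟩
      have := hmin m (by simp [hmk, hl.2])
      exact absurd (lt_of_le_of_lt hm k.castSucc_lt_succ) (not_lt.2 this)
  refine (card_le_card hsub).trans ((card_insert_le _ _).trans ?_)
  gcongr
  exact card_image_le

theorem isFresh_castSucc_iff {α : Type*} {N : ℕ} (u : Fin (N + 2) → α) (k : Fin N) :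
    IsFresh u k.castSucc ↔ IsFresh (fun i => u i.castSucc) k := by
  constructor
  · intro h l hl
    exact h l.castSucc (by simpa using hl)
  · intro h l hl
    have hl' : l.val < N + 1 := by
      have : l.val ≤ k.val := hl
      omega
    exact h ⟨l.val, hl'⟩ hl

open scoped Classical in
theorem card_fresh_succ {α : Type*} {N : ℕ} (t : Fin (N + 2) → α) :
    #{k | IsFresh t k} = #{k | IsFresh (fun i => t i.castSucc) k} +
      if IsFresh t (Fin.last N) then 1 else 0 := by
  simp only [card_filter, Fin.sum_univ_castSucc, isFresh_castSucc_iff]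

theorem exists_eq_last_of_not_isFresh {α : Type*} {N : ℕ} {t : Fin (N + 2) → α}
    (h : ¬ IsFresh t (Fin.last N)) : ∃ l : Fin (N + 1), t l.castSucc = t (Fin.last (N + 1)) := by
  simp only [IsFresh, not_forall, not_not] at h
  obtain ⟨l, hl, hlt⟩ := h
  have hl' : l.val ≤ N := hl
  exact ⟨⟨l.val, by omega⟩, hlt⟩

theorem SamePattern.init {α β : Type*} {N : ℕ} {t : Fin (N + 2) → α} {u : Fin (N + 1) → β} {x : β}
    (h : SamePattern t (Fin.snoc u x : Fin (N + 2) → β)) :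
    SamePattern (fun i => t i.castSucc) u := fun k l => by
  simpa using h k.castSucc l.castSucc

theorem samePattern_snoc {α β : Type*} {N : ℕ} {t : Fin (N + 2) → α} {u : Fin (N + 1) → β} {x : β}
    (h : SamePattern (fun i => t i.castSucc) u)
    (hx : ∀ k, u k = x ↔ t k.castSucc = t (Fin.last (N + 1))) :
    SamePattern t (Fin.snoc u x : Fin (N + 2) → β) := by
  intro k l
  induction k using Fin.lastCases with
  | last =>
    induction l using Fin.lastCases with
    | last => simp
    | cast l => simpa [eq_comm] using hx l
  | cast k =>
    induction l using Fin.lastCases with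
    | last => simpa using hx k
    | cast l => simpa using h k l

theorem sum_walk_succ {β M : Type*} [Fintype β] [AddCommMonoid M] {N : ℕ}
    (F : (Fin (N + 2) → β) → M) :
    ∑ u, F u = ∑ u : Fin (N + 1) → β, ∑ x, F (Fin.snoc u x : Fin (N + 2) → β) := by
  rw [← (Fin.snocEquiv fun _ : Fin (N + 2) => β).sum_comp, Fintype.sum_prod_type_right]
  rfl

-- Induction on the last step: a fresh step costs at most a row sum A, and a step that is not fresh
-- has its endpoint dictated by the pattern. The factor n counts starting points.
open scoped Classical in
theorem sum_samePattern_le {n : ℕ} {a : Fin n → Fin n → ℝ} (ha : ∀ i j, 0 ≤ a i j) {A : ℝ}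
    (hA : ∀ i, ∑ j, a i j ≤ A) (hA0 : 0 ≤ A) {α : Type*} : ∀ (N : ℕ) (t : Fin (N + 1) → α),
    (∑ u : Fin (N + 1) → Fin n, if SamePattern t u then
      ∏ k : Fin N, (if IsFresh t k then a (u k.castSucc) (u k.succ) else 1) else 0) ≤
      n * A ^ #{k | IsFresh t k}
  | 0, t => by
    calc _ ≤ ∑ u : Fin 1 → Fin n, (1 : ℝ) := by
          gcongr with u
          split_ifs <;> simp
      _ = _ := by simp
  | N + 1, t => by
    rw [sum_walk_succ, card_fresh_succ, pow_add, ← mul_assoc]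
    refine le_trans ?_ (mul_le_mul_of_nonneg_right
      (sum_samePattern_le ha hA hA0 N fun i => t i.castSucc) (by positivity))
    rw [sum_mul]
    refine sum_le_sum fun u _ => ?_
    by_cases hu : SamePattern (fun i => t i.castSucc) u
    · rw [if_pos hu]
      set Q := ∏ k : Fin N, (if IsFresh (fun i => t i.castSucc) k then
        a (u k.castSucc) (u k.succ) else 1) with hQ
      have hQ0 : 0 ≤ Q := prod_nonneg fun k _ => by split_ifs <;> simp [ha]
      have hprod : ∀ x, (∏ k : Fin (N + 1), (if IsFresh t k then
          a ((Fin.snoc u x : Fin (N + 2) → Fin n) k.castSucc)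
            ((Fin.snoc u x : Fin (N + 2) → Fin n) k.succ) else 1)) =
          Q * (if IsFresh t (Fin.last N) then a (u (Fin.last N)) x else 1) := by
        intro x
        rw [Fin.prod_univ_castSucc]
        simp only [isFresh_castSucc_iff, ← Fin.castSucc_succ, Fin.snoc_castSucc, Fin.succ_last,
          Fin.snoc_last]
        rfl
      simp only [hprod]
      by_cases hfr : IsFresh t (Fin.last N)
      · simp only [if_pos hfr, pow_one]
        calc _ ≤ ∑ x, Q * a (u (Fin.last N)) x := by
              gcongr with x
              split_ifs
              · exact le_rfl
              · exact mul_nonneg hQ0 (ha _ _)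
          _ = Q * ∑ x, a (u (Fin.last N)) x := (mul_sum _ _ _).symm
          _ ≤ Q * A := by gcongr; exact hA _
      · simp only [if_neg hfr, pow_zero, mul_one]
        -- At most one endpoint is compatible with the pattern, namely the vertex visited at time l.
        obtain ⟨l, hl⟩ := exists_eq_last_of_not_isFresh hfr
        calc _ ≤ ∑ x, if x = u l then Q else 0 := by
              refine sum_le_sum fun x _ => ?_
              by_cases hx : SamePattern t (Fin.snoc u x : Fin (N + 2) → Fin n)
              · rw [if_pos hx, if_pos]
                simpa using ((hx l.castSucc (Fin.last (N + 1))).2 hl).symm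
              · rw [if_neg hx]
                split_ifs
                exacts [hQ0, le_rfl]
          _ = Q := by simp
    · rw [if_neg hu, zero_mul]
      refine (sum_eq_zero fun x _ => if_neg fun h => hu h.init).le

-- The reverse count by the same induction: before a fresh step at most q vertices have been
-- visited, so at least r - q endpoints remain.
open scoped Classical in
theorem mul_pow_le_card_samePattern (r q : ℕ) {α : Type*} : ∀ (N : ℕ) (t : Fin (N + 1) → α),
    #{k | IsFresh t k} ≤ q → r * (r - q) ^ #{k | IsFresh t k} ≤
      #{u : Fin (N + 1) → Fin r | SamePattern t u}
  | 0, t, _ => by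
    have : ({u : Fin 1 → Fin r | SamePattern t u} : Finset _) = univ := by
      ext u
      simp only [mem_filter, mem_univ, true_and, iff_true]
      intro k l
      have hkl : k = l := Fin.ext (by omega)
      simp [hkl]
    simp [this]
  | N + 1, t, hq => by
    rw [card_fresh_succ] at hq
    rw [card_filter (fun u => SamePattern t u), sum_walk_succ, card_fresh_succ, pow_add, ← mul_assoc]
    refine le_trans (Nat.mul_le_mul_right _
      (mul_pow_le_card_samePattern r q N (fun i => t i.castSucc) (by omega))) ?_
    rw [card_filter (fun u => SamePattern _ u), sum_mul]
    refine sum_le_sum fun u _ => ?_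
    by_cases hu : SamePattern (fun i => t i.castSucc) u
    · rw [if_pos hu, one_mul, ← card_filter]
      by_cases hfr : IsFresh t (Fin.last N)
      · rw [if_pos hfr] at hq ⊢
        have hsub : univ \ univ.image u ⊆
            ({x | SamePattern t (Fin.snoc u x : Fin (N + 2) → Fin r)} : Finset (Fin r)) := by
          intro x hx
          simp only [mem_sdiff, mem_univ, mem_image, true_and, not_exists] at hx
          rw [mem_filter]
          refine ⟨mem_univ _, samePattern_snoc hu fun k => ?_⟩
          exact iff_of_false (hx k) (hfr k.castSucc (Fin.castSucc_le_castSucc_iff.2 k.le_last))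
        have hcard := card_le_card hsub
        rw [card_sdiff_of_subset (subset_univ _), card_univ, Fintype.card_fin] at hcard
        have himg := card_image_le_card_fresh u
        simp only [hu.isFresh_iff] at himg
        rw [pow_one]
        omega
      · rw [if_neg hfr, pow_zero]
        obtain ⟨l, hl⟩ := exists_eq_last_of_not_isFresh hfr
        refine card_pos.2 ⟨u l, mem_filter.2 ⟨mem_univ _, samePattern_snoc hu fun k => ?_⟩⟩
        rw [← hl]
        exact hu k l
    · simp [if_neg hu]

/-! ### Edges of walks and the comparison of dimensions -/

/-- The unordered pair `{i, j}`, listed in increasing order. -/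
def sortedPair {n : ℕ} (i j : Fin n) : {p : Fin n × Fin n // p.1 ≤ p.2} :=
  ⟨(min i j, max i j), min_le_max⟩

theorem sortedPair_eq_iff {n : ℕ} {i j k l : Fin n} :
    sortedPair i j = sortedPair k l ↔ (i = k ∧ j = l) ∨ (i = l ∧ j = k) := by
  simp only [sortedPair, Subtype.mk.injEq, Prod.mk.injEq]
  rcases le_total i j with h | h <;> rcases le_total k l with h' | h' <;>
    simp only [h, h', min_eq_left, min_eq_right, max_eq_left, max_eq_right] <;>
    · constructor
      · rintro ⟨rfl, rfl⟩
        simp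
      · rintro (⟨rfl, rfl⟩ | ⟨rfl, rfl⟩)
        · first | exact ⟨rfl, rfl⟩ | exact ⟨le_antisymm ‹_› ‹_›, le_antisymm ‹_› ‹_›⟩
        · first | exact ⟨rfl, rfl⟩ | exact ⟨le_antisymm ‹_› ‹_›, le_antisymm ‹_› ‹_›⟩

/-- The edge that the walk `u` traverses in step `k`. -/
def walkEdge {n N : ℕ} (u : Fin (N + 1) → Fin n) (k : Fin N) : {p : Fin n × Fin n // p.1 ≤ p.2} :=
  sortedPair (u k.castSucc) (u k.succ)

theorem SamePattern.walkEdge_eq_iff {n r N : ℕ} {t : Fin (N + 1) → Fin n} {u : Fin (N + 1) → Fin r}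
    (h : SamePattern t u) (k l : Fin N) : walkEdge u k = walkEdge u l ↔ walkEdge t k = walkEdge t l := by
  simp only [walkEdge, sortedPair_eq_iff, h _ _]

theorem walkEdge_ne_of_isFresh {n N : ℕ} {u : Fin (N + 1) → Fin n} {k l : Fin N} (hkl : k < l)
    (hl : IsFresh u l) : walkEdge u k ≠ walkEdge u l := by
  have h1 : u k.castSucc ≠ u l.succ := hl _ (Fin.castSucc_le_castSucc_iff.2 hkl.le)
  have h2 : u k.succ ≠ u l.succ := hl _ (Fin.succ_le_castSucc_iff.2 hkl)
  simp only [walkEdge, ne_eq, sortedPair_eq_iff]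
  tauto

/-- The edge of a fresh step has an endpoint that no earlier edge of the walk contains. -/
theorem injOn_walkEdge {n N : ℕ} (u : Fin (N + 1) → Fin n) :
    Set.InjOn (walkEdge u) {k | IsFresh u k} := by
  intro k hk l hl hkl
  rcases lt_trichotomy k l with h | h | h
  · exact absurd hkl (walkEdge_ne_of_isFresh h hl)
  · exact h
  · exact absurd hkl.symm (walkEdge_ne_of_isFresh h hk)

-- The comparison for a single pattern: with m fresh steps, both sides are compared with n · 2p ·
-- p^m.
open scoped Classical in
theorem mul_sum_samePattern_le {n p : ℕ} {b : Fin n → Fin n → ℝ} (hb0 : ∀ i j, 0 ≤ b i j)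
    (hb1 : ∀ i j, b i j ≤ 1) (hbs : ∀ i j, b i j = b j i) (hbp : ∀ i, ∑ j, b i j ^ 2 ≤ p)
    {γ : ℕ → ℝ} (h1 : γ 1 = 0) (t : Fin (2 * p + 1) → Fin n)
    (ht : mixedMoment γ (walkEdge t) ≠ 0) :
    ((2 * p : ℕ) : ℝ) * (∑ u : Fin (2 * p + 1) → Fin n, if SamePattern t u then
      ∏ k : Fin (2 * p), b (u k.castSucc) (u k.succ) else 0) ≤
      n * #{v : Fin (2 * p + 1) → Fin (2 * p) | SamePattern t v} := by
  have hinj : Set.InjOn (walkEdge t) (({k | IsFresh t k} : Finset (Fin (2 * p))) : Set _) := by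
    simpa using injOn_walkEdge t
  have hcard : #{k | IsFresh t k} ≤ p := by
    have := two_mul_card_le_of_partner hinj fun k _ => exists_ne_of_mixedMoment_ne_zero h1 ht k
    rw [Fintype.card_fin] at this
    omega
  have hcount := mul_pow_le_card_samePattern (2 * p) p (2 * p) t hcard
  -- With 2p vertices available and at most p fresh steps, each fresh step has at least p choices,
  -- matching the bound p on the squared rows.
  rw [show 2 * p - p = p by omega] at hcount
  have hsum := sum_samePattern_le (a := fun i j => b i j ^ 2) (fun i j => sq_nonneg _) hbp
    (Nat.cast_nonneg p) (2 * p) t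
  have hle : (∑ u : Fin (2 * p + 1) → Fin n, if SamePattern t u then
      ∏ k : Fin (2 * p), b (u k.castSucc) (u k.succ) else 0) ≤
      n * (p : ℝ) ^ #{k | IsFresh t k} := by
    refine le_trans (sum_le_sum fun u _ => ?_) hsum
    split_ifs with hu
    · rw [← prod_filter]
      refine prod_le_prod_sq_of_partner (e := walkEdge t)
        (f := fun k => b (u k.castSucc) (u k.succ)) hinj
        (fun k _ => exists_ne_of_mixedMoment_ne_zero h1 ht k) (fun k => hb0 _ _)
        (fun k => hb1 _ _) fun k l hkl => ?_
      rcases sortedPair_eq_iff.1 ((hu.walkEdge_eq_iff k l).2 hkl) with ⟨h, h'⟩ | ⟨h, h'⟩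
      · rw [h, h']
      · rw [h, h', hbs]
    · exact le_rfl
  calc _ ≤ ((2 * p : ℕ) : ℝ) * (n * (p : ℝ) ^ #{k | IsFresh t k}) := by gcongr
    _ = n * ((2 * p * p ^ #{k | IsFresh t k} : ℕ) : ℝ) := by push_cast; ring
    _ ≤ _ := by gcongr

open scoped Classical in
/-- Comparison of the weighted closed walks of length `2 p` on `n` vertices with the unweighted
ones on `2 p` vertices. -/
theorem mul_sum_closed_walks_le {n p : ℕ} {b : Fin n → Fin n → ℝ} (hb0 : ∀ i j, 0 ≤ b i j)
    (hb1 : ∀ i j, b i j ≤ 1) (hbs : ∀ i j, b i j = b j i) (hbp : ∀ i, ∑ j, b i j ^ 2 ≤ p)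
    {γ : ℕ → ℝ} (h0 : γ 0 = 1) (h1 : γ 1 = 0) (hγ : ∀ m, 0 ≤ γ m) :
    ((2 * p : ℕ) : ℝ) * (∑ u : Fin (2 * p + 1) → Fin n, if u 0 = u (Fin.last _) then
      (∏ k : Fin (2 * p), b (u k.castSucc) (u k.succ)) * mixedMoment γ (walkEdge u) else 0) ≤
      n * ∑ v : Fin (2 * p + 1) → Fin (2 * p), if v 0 = v (Fin.last _) then
        mixedMoment γ (walkEdge v) else 0 := by
  set F : (Fin (2 * p + 1) → Fin n) → ℝ := fun u => if u 0 = u (Fin.last _) then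
      (∏ k : Fin (2 * p), b (u k.castSucc) (u k.succ)) * mixedMoment γ (walkEdge u) else 0 with hF
  set G : (Fin (2 * p + 1) → Fin (2 * p)) → ℝ := fun v => if v 0 = v (Fin.last _) then
        mixedMoment γ (walkEdge v) else 0 with hG
  have hG0 : ∀ v, 0 ≤ G v := fun v => by
    simp only [hG]
    split_ifs
    exacts [mixedMoment_nonneg hγ _, le_rfl]
  -- The coincidence relation of a walk has a type independent of the number of vertices, so both
  -- sums can be split over the same patterns.
  let κ : ∀ {m : ℕ}, (Fin (2 * p + 1) → Fin m) → Fin (2 * p + 1) → Fin (2 * p + 1) → Prop :=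
    fun u k l => u k = u l
  have hκ : ∀ {m m' : ℕ} (t : Fin (2 * p + 1) → Fin m) (u : Fin (2 * p + 1) → Fin m'),
      κ u = κ t ↔ SamePattern t u := by
    intro m m' t u
    simp only [κ, funext_iff, eq_iff_iff]
    rfl
  rw [← sum_fiberwise univ κ F, ← sum_fiberwise univ κ G, mul_sum, mul_sum]
  refine sum_le_sum fun c _ => ?_
  by_cases hc : ∃ t : Fin (2 * p + 1) → Fin n, κ t = c ∧ F t ≠ 0
  · obtain ⟨t, rfl, ht⟩ := hc
    have htc : t 0 = t (Fin.last _) := by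
      by_contra h
      exact ht (if_neg h)
    have htm : mixedMoment γ (walkEdge t) ≠ 0 := by
      intro h
      exact ht (by simp [hF, h])
    have hFt : ∑ u with κ u = κ t, F u = mixedMoment γ (walkEdge t) *
        ∑ u : Fin (2 * p + 1) → Fin n, if SamePattern t u then
          ∏ k : Fin (2 * p), b (u k.castSucc) (u k.succ) else 0 := by
      rw [sum_filter, mul_sum]
      refine sum_congr rfl fun u _ => ?_
      simp only [hκ]
      split_ifs with hu
      · simp only [hF]
        rw [if_pos ((hu _ _).2 htc), mixedMoment_congr h0 hu.walkEdge_eq_iff, mul_comm]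
      · rw [mul_zero]
    have hGt : ∑ v with κ v = κ t, G v = mixedMoment γ (walkEdge t) *
        #{v : Fin (2 * p + 1) → Fin (2 * p) | SamePattern t v} := by
      simp only [hκ]
      rw [sum_congr rfl (g := fun _ => mixedMoment γ (walkEdge t)), sum_const, nsmul_eq_mul,
        mul_comm]
      intro v hv
      rw [mem_filter] at hv
      simp only [hG]
      rw [if_pos ((hv.2 _ _).2 htc), mixedMoment_congr h0 hv.2.walkEdge_eq_iff]
    rw [hFt, hGt, mul_left_comm, mul_left_comm (n : ℝ)]
    exact mul_le_mul_of_nonneg_left (mul_sum_samePattern_le hb0 hb1 hbs hbp h1 t htm)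
      (mixedMoment_nonneg hγ _)
  · push Not at hc
    rw [sum_eq_zero fun u hu => hc u (mem_filter.1 hu).2, mul_zero]
    exact mul_nonneg (Nat.cast_nonneg _) (sum_nonneg fun v _ => hG0 v)

/-! ### Spectral norm, traces of powers and closed walks -/

theorem matrixSpectralNorm_eq_norm {n : ℕ} (hn : 0 < n) (A : Matrix (Fin n) (Fin n) ℝ) :
    matrixSpectralNorm A = ‖A‖ :=
  matrixSpectralNorm_eq_opNorm hn A

theorem Matrix.abs_entry_le_norm {n : ℕ} (A : Matrix (Fin n) (Fin n) ℝ) (i j : Fin n) :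
    |A i j| ≤ ‖A‖ := by
  have h := A.l2_opNorm_mulVec (EuclideanSpace.single j 1)
  rw [PiLp.norm_single, norm_one, mul_one] at h
  refine le_trans ?_ h
  refine le_trans (le_of_eq ?_) (PiLp.norm_apply_le _ i)
  simp [Matrix.mulVec_single]

theorem Matrix.sqrt_sum_sq_row_le_norm {n : ℕ} (A : Matrix (Fin n) (Fin n) ℝ) (i : Fin n) :
    √(∑ j, A i j ^ 2) ≤ ‖A‖ := by
  have h := A.transpose.l2_opNorm_mulVec (EuclideanSpace.single i 1)
  rw [PiLp.norm_single, norm_one, mul_one] at h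
  have ht : ‖A.transpose‖ = ‖A‖ := by
    rw [← Matrix.conjTranspose_eq_transpose_of_trivial, Matrix.l2_opNorm_conjTranspose]
  rw [ht] at h
  refine le_trans (le_of_eq ?_) h
  rw [EuclideanSpace.norm_eq]
  simp [Matrix.mulVec_single]

theorem Matrix.norm_pow_le_trace_pow {n p : ℕ} (hn : 0 < n)
    {A : Matrix (Fin n) (Fin n) ℝ} (hA : A.IsHermitian) :
    ‖A‖ ^ (2 * p) ≤ (A ^ (2 * p)).trace := by
  have : Nonempty (Fin n) := ⟨⟨0, hn⟩⟩
  have hs := hA.spectral_theorem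
  have htr : (A ^ (2 * p)).trace = ∑ i, hA.eigenvalues i ^ (2 * p) := by
    conv_lhs => rw [hs]
    rw [← map_pow, Matrix.diagonal_pow, Unitary.conjStarAlgAut_apply, Matrix.trace_mul_cycle,
      Unitary.coe_star_mul_self, one_mul, Matrix.trace_diagonal]
    simp
  have hnorm : ‖A‖ = ‖hA.eigenvalues‖ := by
    conv_lhs => rw [hs]
    rw [Unitary.conjStarAlgAut_apply, ← Unitary.coe_star, CStarRing.norm_mul_coe_unitary,
      CStarRing.norm_coe_unitary_mul, Matrix.l2_opNorm_diagonal]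
    rfl
  obtain ⟨i, hi⟩ := Finite.exists_max fun i => ‖hA.eigenvalues i‖
  have h1 : ‖hA.eigenvalues‖ ≤ ‖hA.eigenvalues i‖ := (pi_norm_le_iff_of_nonneg (norm_nonneg _)).2 hi
  calc ‖A‖ ^ (2 * p) ≤ ‖hA.eigenvalues i‖ ^ (2 * p) := by rw [hnorm]; gcongr
    _ = hA.eigenvalues i ^ (2 * p) := by rw [Real.norm_eq_abs, pow_mul, sq_abs, ← pow_mul]
    _ ≤ _ := by
        rw [htr]
        exact single_le_sum (f := fun i => hA.eigenvalues i ^ (2 * p))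
          (fun j _ => (even_two_mul p).pow_nonneg _) (mem_univ i)

theorem Matrix.trace_pow_le {n N : ℕ} (hN : 0 < N) (A : Matrix (Fin n) (Fin n) ℝ) :
    (A ^ N).trace ≤ n * ‖A‖ ^ N := by
  calc (A ^ N).trace ≤ ∑ i : Fin n, ‖A‖ ^ N :=
        sum_le_sum fun i _ => (le_abs_self _).trans
          (((A ^ N).abs_entry_le_norm i i).trans (norm_pow_le' A hN))
    _ = _ := by simp

theorem Matrix.pow_apply_eq_sum_walks {n : ℕ} (A : Matrix (Fin n) (Fin n) ℝ) (i : Fin n) :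
    ∀ (N : ℕ) (j : Fin n), (A ^ N) i j = ∑ u : Fin (N + 1) → Fin n,
      if u 0 = i ∧ u (Fin.last N) = j then ∏ k : Fin N, A (u k.castSucc) (u k.succ) else 0
  | 0, j => by
    rw [← (Equiv.funUnique (Fin 1) (Fin n)).symm.sum_comp]
    simp only [pow_zero, Matrix.one_apply]
    simp [ite_and, eq_comm]
  | N + 1, j => by
    rw [pow_succ, Matrix.mul_apply, sum_walk_succ]
    simp only [Matrix.pow_apply_eq_sum_walks A i N, sum_mul]
    rw [sum_comm]
    refine sum_congr rfl fun u _ => ?_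
    have h0 : ∀ x, (Fin.snoc u x : Fin (N + 2) → Fin n) 0 = u 0 := fun x =>
      Fin.snoc_castSucc (α := fun _ => Fin n) x u 0
    simp only [h0, Fin.snoc_last, Fin.prod_univ_castSucc, ← Fin.castSucc_succ, Fin.snoc_castSucc,
      Fin.succ_last, ite_and, ite_mul, zero_mul]
    by_cases hi : u 0 = i <;> simp [hi]

theorem Matrix.trace_pow_eq_sum_walks {n : ℕ} (A : Matrix (Fin n) (Fin n) ℝ) (N : ℕ) :
    (A ^ N).trace = ∑ u : Fin (N + 1) → Fin n,
      if u 0 = u (Fin.last N) then ∏ k : Fin N, A (u k.castSucc) (u k.succ) else 0 := by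
  simp only [Matrix.trace, Matrix.diag_apply, Matrix.pow_apply_eq_sum_walks]
  rw [sum_comm]
  refine sum_congr rfl fun u _ => ?_
  simp [ite_and, eq_comm]

/-! ### Gaussian moments and expected traces -/

/-- The moments of the standard Gaussian distribution. -/
def gaussianMoment (m : ℕ) : ℝ := ∫ x, x ^ m ∂gaussianReal 0 1

theorem gaussianMoment_zero : gaussianMoment 0 = 1 := by simp [gaussianMoment]

theorem gaussianMoment_one : gaussianMoment 1 = 0 := by simp [gaussianMoment]

/-- Odd moments vanish by symmetry. Nonnegativity is what permits comparing walk sums pattern by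
pattern. -/
theorem gaussianMoment_nonneg (m : ℕ) : 0 ≤ gaussianMoment m := by
  rcases Nat.even_or_odd m with h | h
  · exact integral_nonneg fun x => h.pow_nonneg x
  · have hneg : gaussianMoment m = -gaussianMoment m := by
      have hmap : (gaussianReal 0 1).map (fun x : ℝ => -x) = gaussianReal 0 1 := by
        simp [gaussianReal_map_neg]
      unfold gaussianMoment
      conv_lhs => rw [← hmap]
      rw [integral_map (by fun_prop) (by fun_prop), ← integral_neg]
      simp [h.neg_pow]
    linarith

theorem trace_structuredMatrix_pow {Ω : Type*} {n : ℕ} (b : Fin n → Fin n → ℝ)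
    (g : Fin n → Fin n → Ω → ℝ) (N : ℕ) (ω : Ω) :
    (structuredMatrix b g ω ^ N).trace = ∑ u : Fin (N + 1) → Fin n,
      if u 0 = u (Fin.last N) then (∏ k : Fin N, b (u k.castSucc) (u k.succ)) *
        ∏ k : Fin N, g (u k.castSucc) (u k.succ) ω else 0 := by
  rw [Matrix.trace_pow_eq_sum_walks]
  simp only [structuredMatrix, Matrix.of_apply, prod_mul_distrib]

namespace IsSymmetricGaussianArray

variable {Ω : Type*} [MeasurableSpace Ω] {n : ℕ} {g : Fin n → Fin n → Ω → ℝ} {P : Measure Ω}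

theorem memLp (hg : IsSymmetricGaussianArray g P) (i j : Fin n) {q : ENNReal} (hq : q ≠ ⊤) :
    MemLp (g i j) q P := by
  have h := memLp_id_gaussianReal' (μ := 0) (v := 1) q hq
  rw [← (hg.law i j).map_eq] at h
  exact (memLp_map_measure_iff (by fun_prop) (hg.law i j).aemeasurable).1 h

theorem integral_pow (hg : IsSymmetricGaussianArray g P) (i j : Fin n) (m : ℕ) :
    ∫ ω, g i j ω ^ m ∂P = gaussianMoment m := by
  rw [gaussianMoment, ← (hg.law i j).map_eq,
    integral_map (hg.law i j).aemeasurable (by fun_prop)]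

theorem eq_sortedPair (hg : IsSymmetricGaussianArray g P) (i j : Fin n) :
    g i j = g (sortedPair i j).1.1 (sortedPair i j).1.2 := by
  rcases le_total i j with h | h
  · simp [sortedPair, h]
  · simp [sortedPair, h, hg.symm i j]

theorem integrable_prod [IsProbabilityMeasure P] (hg : IsSymmetricGaussianArray g P)
    {N : ℕ} (hN : 0 < N)
    (i j : Fin N → Fin n) : Integrable (fun ω => ∏ k, g (i k) (j k) ω) P := by
  -- Hölder's inequality with all N exponents equal to N.
  have h := MemLp.prod' (s := univ) (f := fun k : Fin N => g (i k) (j k)) (p := fun _ => N) (μ := P)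
    fun k _ => hg.memLp _ _ (by simp)
  rw [← memLp_one_iff_integrable]
  convert h
  rw [sum_const, card_univ, Fintype.card_fin, nsmul_eq_mul, ENNReal.mul_inv_cancel (by simp; omega)
    (by simp),
    inv_one]

theorem integral_prod_walk (hg : IsSymmetricGaussianArray g P) {N : ℕ}
    (u : Fin (N + 1) → Fin n) :
    ∫ ω, ∏ k : Fin N, g (u k.castSucc) (u k.succ) ω ∂P =
      mixedMoment gaussianMoment (walkEdge u) := by
  have h1 : ∀ ω, ∏ k : Fin N, g (u k.castSucc) (u k.succ) ω =
      ∏ a : {p : Fin n × Fin n // p.1 ≤ p.2}, g a.1.1 a.1.2 ω ^ #{k | walkEdge u k = a} := by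
    intro ω
    rw [← prod_fiberwise univ (walkEdge u)]
    refine prod_congr rfl fun a _ => ?_
    rw [prod_congr rfl (g := fun _ => g a.1.1 a.1.2 ω), prod_const]
    intro k hk
    rw [hg.eq_sortedPair, ← (mem_filter.1 hk).2]
    rfl
  simp only [h1]
  rw [hg.indep.integral_fun_prod_comp (f := fun a x => x ^ #{k | walkEdge u k = a})
    (fun a => (hg.law _ _).aemeasurable) (fun a => by fun_prop)]
  exact prod_congr rfl fun a _ => hg.integral_pow _ _ _

theorem integrable_trace_pow [IsProbabilityMeasure P] (hg : IsSymmetricGaussianArray g P)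
    (b : Fin n → Fin n → ℝ) {N : ℕ}
    (hN : 0 < N) : Integrable (fun ω => (structuredMatrix b g ω ^ N).trace) P := by
  simp only [trace_structuredMatrix_pow]
  refine integrable_finsetSum _ fun u _ => ?_
  split_ifs
  · exact (hg.integrable_prod hN _ _).const_mul _
  · exact integrable_zero _ _ _

theorem integral_trace_pow [IsProbabilityMeasure P] (hg : IsSymmetricGaussianArray g P)
    (b : Fin n → Fin n → ℝ) {N : ℕ}
    (hN : 0 < N) :
    ∫ ω, (structuredMatrix b g ω ^ N).trace ∂P = ∑ u : Fin (N + 1) → Fin n,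
      if u 0 = u (Fin.last N) then (∏ k : Fin N, b (u k.castSucc) (u k.succ)) *
        mixedMoment gaussianMoment (walkEdge u) else 0 := by
  simp only [trace_structuredMatrix_pow]
  rw [integral_finsetSum]
  · refine sum_congr rfl fun u _ => ?_
    split_ifs
    · rw [integral_const_mul, hg.integral_prod_walk]
    · simp
  · intro u _
    split_ifs
    · exact (hg.integrable_prod hN _ _).const_mul _
    · exact integrable_zero _ _ _

theorem aemeasurable_norm (hg : IsSymmetricGaussianArray g P) (b : Fin n → Fin n → ℝ) :
    AEMeasurable (fun ω => ‖structuredMatrix b g ω‖) P := by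
  have hc : Continuous fun x : Fin n → Fin n → ℝ => ‖(Matrix.of x : Matrix (Fin n) (Fin n) ℝ)‖ :=
    continuous_norm.comp continuous_id
  refine hc.measurable.comp_aemeasurable ?_
  refine aemeasurable_pi_lambda _ fun i => aemeasurable_pi_lambda _ fun j => ?_
  exact (hg.law i j).aemeasurable.const_mul _

theorem isHermitian (hg : IsSymmetricGaussianArray g P) {b : Fin n → Fin n → ℝ}
    (hb : ∀ i j, b i j = b j i) (ω : Ω) : (structuredMatrix b g ω).IsHermitian := by
  ext i j
  simp [structuredMatrix, hb i j, hg.symm i j]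

theorem integrable_norm_pow [IsProbabilityMeasure P] (hg : IsSymmetricGaussianArray g P)
    {b : Fin n → Fin n → ℝ}
    (hb : ∀ i j, b i j = b j i) (hn : 0 < n) {p : ℕ} (hp : 0 < p) :
    Integrable (fun ω => ‖structuredMatrix b g ω‖ ^ (2 * p)) P := by
  refine (hg.integrable_trace_pow b (N := 2 * p) (by omega)).mono'
    ((hg.aemeasurable_norm b).pow_const _).aestronglyMeasurable (ae_of_all _ fun ω => ?_)
  rw [Real.norm_eq_abs, abs_of_nonneg (by positivity)]
  exact Matrix.norm_pow_le_trace_pow hn (hg.isHermitian hb ω)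

end IsSymmetricGaussianArray

/-! ### Sub-Gaussian moments, nets and the unweighted matrix -/

theorem ProbabilityTheory.HasSubgaussianMGF.integrable_pow {Ω : Type*} [MeasurableSpace Ω]
    {P : Measure Ω} [IsProbabilityMeasure P] {X : Ω → ℝ} {c : NNReal}
    (hX : HasSubgaussianMGF X c P) (m : ℕ) :
    Integrable (fun ω => X ω ^ m) P :=
  (((hX.memLp m).integrable_norm_pow').mono (hX.aestronglyMeasurable.pow m)
    (ae_of_all _ fun ω => by simp))

theorem ProbabilityTheory.HasSubgaussianMGF.integral_pow_le {Ω : Type*} [MeasurableSpace Ω]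
    {P : Measure Ω} [IsProbabilityMeasure P] {X : Ω → ℝ} {c : NNReal}
    (hX : HasSubgaussianMGF X c P) {V : ℝ}
    (hV : 0 < V) (hc : (c : ℝ) ≤ V) {p : ℕ} (hp : 0 < p) :
    ∫ ω, X ω ^ (2 * p) ∂P ≤ 2 * (2 * Real.exp 1 * V * p) ^ p := by
  have hp' : (0 : ℝ) < p := Nat.cast_pos.2 hp
  -- This t makes the moment generating function bound exp(c t²/2) at most e^p.
  set t : ℝ := √(2 * p / V) with ht
  have ht0 : 0 < t := Real.sqrt_pos.2 (by positivity)
  have ht2 : t ^ 2 = 2 * p / V := Real.sq_sqrt (by positivity)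
  have hpt : ∀ ω, X ω ^ (2 * p) ≤
      (2 * p).factorial / t ^ (2 * p) * (Real.exp (t * X ω) + Real.exp (-t * X ω)) := by
    intro ω
    have h1 := Real.pow_div_factorial_le_exp |t * X ω| (abs_nonneg _) (2 * p)
    have h2 : |t * X ω| ^ (2 * p) = t ^ (2 * p) * X ω ^ (2 * p) := by
      rw [(even_two_mul p).pow_abs, mul_pow]
    have h3 : Real.exp |t * X ω| ≤ Real.exp (t * X ω) + Real.exp (-t * X ω) := by
      rw [neg_mul]
      exact Real.exp_abs_le _
    rw [h2, div_le_iff₀ (by positivity)] at h1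
    rw [div_mul_eq_mul_div, le_div_iff₀ (by positivity), mul_comm (X ω ^ _)]
    refine h1.trans ?_
    rw [mul_comm]
    gcongr
  have hexp : ∀ s : ℝ, s ^ 2 = t ^ 2 → ∫ ω, Real.exp (s * X ω) ∂P ≤ Real.exp p := by
    intro s hs
    refine (hX.mgf_le s).trans (Real.exp_le_exp.2 ?_)
    rw [hs, ht2]
    calc (c : ℝ) * (2 * p / V) / 2 ≤ V * (2 * p / V) / 2 := by gcongr
      _ = p := by field_simp
  calc ∫ ω, X ω ^ (2 * p) ∂P
      ≤ ∫ ω, (2 * p).factorial / t ^ (2 * p) * (Real.exp (t * X ω) + Real.exp (-t * X ω)) ∂P :=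
        integral_mono (hX.integrable_pow _)
          (((hX.integrable_exp_mul _).add (hX.integrable_exp_mul _)).const_mul _) hpt
    _ = (2 * p).factorial / t ^ (2 * p) *
        (∫ ω, Real.exp (t * X ω) ∂P + ∫ ω, Real.exp (-t * X ω) ∂P) := by
        rw [integral_const_mul, integral_add (hX.integrable_exp_mul _) (hX.integrable_exp_mul _)]
    _ ≤ (2 * p : ℕ) ^ (2 * p) / t ^ (2 * p) * (Real.exp p + Real.exp p) := by
        gcongr
        · exact_mod_cast Nat.factorial_le_pow _
        · exact hexp t rfl
        · exact hexp (-t) (by ring)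
    _ = 2 * (2 * Real.exp 1 * V * p) ^ p := by
        rw [pow_mul t, ht2, pow_mul (((2 * p : ℕ)) : ℝ), ← div_pow, ← two_mul, mul_left_comm,
          ← Real.exp_one_pow p, ← mul_pow]
        congr 2
        push_cast
        field_simp

theorem hasSubgaussianMGF_of_hasLaw_gaussianReal {Ω : Type*} [MeasurableSpace Ω] {P : Measure Ω}
    {X : Ω → ℝ} (hX : HasLaw X (gaussianReal 0 1) P) : HasSubgaussianMGF X 1 P where
  integrable_exp_mul t := by
    have h := integrable_exp_mul_gaussianReal (μ := 0) (v := 1) t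
    rw [← hX.map_eq] at h
    exact h.comp_aemeasurable hX.aemeasurable
  mgf_le t := by
    rw [mgf_gaussianReal hX.map_eq]
    simp

/-- A 1-separated set of maximal cardinality in the ball of radius 2 is a net; its size is bounded
by the volume argument behind `Besicovitch.card_le_of_separated`. -/
theorem exists_finset_card_le_forall_norm_sub_lt_one (E : Type*) [NormedAddCommGroup E]
    [NormedSpace ℝ E] [FiniteDimensional ℝ E] :
    ∃ s : Finset E, #s ≤ 5 ^ Module.finrank ℝ E ∧ (∀ c ∈ s, ‖c‖ ≤ 2) ∧
      ∀ v : E, ‖v‖ ≤ 2 → ∃ c ∈ s, ‖v - c‖ < 1 := by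
  classical
  let S : ℕ → Prop := fun m => ∃ s : Finset E, #s = m ∧ (∀ c ∈ s, ‖c‖ ≤ 2) ∧
    ∀ c ∈ s, ∀ d ∈ s, c ≠ d → 1 ≤ ‖c - d‖
  have hb : ∀ m, S m → m ≤ 5 ^ Module.finrank ℝ E := by
    rintro m ⟨s, rfl, hs, hsep⟩
    exact Besicovitch.card_le_of_separated s hs hsep
  have h0 : S 0 := ⟨∅, by simp⟩
  obtain ⟨s, hcard, hs, hsep⟩ := Nat.findGreatest_spec (P := S)
    (n := 5 ^ Module.finrank ℝ E) (Nat.zero_le _) h0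
  refine ⟨s, hcard ▸ hb _ ⟨s, hcard, hs, hsep⟩, hs, fun v hv => ?_⟩
  by_contra! hfar
  have hvs : v ∉ s := fun h => by simpa using (hfar v h).trans_lt' zero_lt_one
  have hS : S (#s + 1) := by
    refine ⟨insert v s, card_insert_of_notMem hvs, ?_, ?_⟩
    · simpa [forall_mem_insert] using ⟨hv, hs⟩
    · intro c hc d hd hcd
      rcases mem_insert.1 hc with rfl | hc' <;> rcases mem_insert.1 hd with rfl | hd'
      · exact absurd rfl hcd
      · exact hfar _ hd'
      · rw [norm_sub_rev]
        exact hfar _ hc'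
      · exact hsep _ hc' _ hd' hcd
  have := Nat.le_findGreatest (hb _ hS) hS
  rw [← hcard] at this
  omega

theorem exists_norm_le_inner_of_net {E : Type*} [NormedAddCommGroup E] [InnerProductSpace ℝ E]
    {s : Finset E} (hs : ∀ v : E, ‖v‖ ≤ 2 → ∃ c ∈ s, ‖v - c‖ < 1) (w : E) :
    ∃ d ∈ s, ‖w‖ ≤ inner ℝ d w := by
  rcases eq_or_ne w 0 with rfl | hw
  · obtain ⟨d, hd, -⟩ := hs 0 (by simp)
    exact ⟨d, hd, by simp⟩
  · have hw0 : 0 < ‖w‖ := norm_pos_iff.2 hw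
    set v : E := (2 / ‖w‖) • w with hv
    have hvn : ‖v‖ = 2 := by
      rw [hv, norm_smul, Real.norm_eq_abs, abs_of_pos (by positivity)]
      field_simp
    obtain ⟨d, hd, hvd⟩ := hs v hvn.le
    refine ⟨d, hd, ?_⟩
    -- Radius 2 yields 2‖w‖, and replacing v by a net point loses at most ‖w‖, so the net attains
    -- the norm without a constant.
    have h1 : inner ℝ v w = 2 * ‖w‖ := by
      rw [hv, real_inner_smul_left, real_inner_self_eq_norm_sq]
      field_simp
    have h2 : inner ℝ (v - d) w ≤ ‖w‖ :=
      (real_inner_le_norm _ _).trans (mul_le_of_le_one_left hw0.le hvd.le)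
    rw [inner_sub_left] at h2
    linarith

theorem exists_opNorm_le_inner_of_net {E : Type*} [NormedAddCommGroup E] [InnerProductSpace ℝ E]
    {s : Finset E} (hs : ∀ v : E, ‖v‖ ≤ 2 → ∃ c ∈ s, ‖v - c‖ < 1) (T : E →L[ℝ] E) :
    ∃ c ∈ s, ∃ d ∈ s, ‖T‖ ≤ inner ℝ d (T c) := by
  obtain ⟨c₀, hc₀, -⟩ := hs 0 (by simp)
  obtain ⟨c, hc, hmax⟩ := exists_max_image s (fun c => ‖T c‖) ⟨c₀, hc₀⟩
  obtain ⟨d, hd, hdc⟩ := exists_norm_le_inner_of_net hs (T c)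
  refine ⟨c, hc, d, hd, le_trans ?_ hdc⟩
  -- Approximating a vector of norm 2 by the net bounds 2‖T‖ by ‖T c‖ + ‖T‖; one copy of ‖T‖ is
  -- absorbed on the left.
  have h : ‖T‖ ≤ (‖T c‖ + ‖T‖) / 2 := by
    refine T.opNorm_le_bound (by positivity) fun x => ?_
    rcases eq_or_ne x 0 with rfl | hx
    · simp
    have hx0 : 0 < ‖x‖ := norm_pos_iff.2 hx
    set v : E := (2 / ‖x‖) • x with hv
    have hvn : ‖v‖ = 2 := by
      rw [hv, norm_smul, Real.norm_eq_abs, abs_of_pos (by positivity)]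
      field_simp
    obtain ⟨a, ha, hva⟩ := hs v hvn.le
    have h1 : ‖T v‖ ≤ ‖T c‖ + ‖T‖ := by
      calc ‖T v‖ = ‖T a + T (v - a)‖ := by rw [← map_add, add_sub_cancel]
        _ ≤ ‖T a‖ + ‖T (v - a)‖ := norm_add_le _ _
        _ ≤ ‖T c‖ + ‖T‖ := by
            gcongr
            · exact hmax a ha
            · exact (T.le_opNorm _).trans (mul_le_of_le_one_right (norm_nonneg _) hva.le)
    have h2 : ‖T v‖ = 2 / ‖x‖ * ‖T x‖ := by
      rw [hv, map_smul, norm_smul, Real.norm_eq_abs, abs_of_pos (by positivity)]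
    rw [h2, div_mul_eq_mul_div, div_le_iff₀ hx0] at h1
    linarith
  linarith

theorem card_sortedPair_fiber_le {n : ℕ} (a : {p : Fin n × Fin n // p.1 ≤ p.2}) :
    #{p : Fin n × Fin n | sortedPair p.1 p.2 = a} ≤ 2 := by
  refine (card_le_card (t := {a.1, a.1.swap}) fun p hp => ?_).trans card_le_two
  have h := (mem_filter.1 hp).2
  rw [← h]
  rcases le_total p.1 p.2 with h' | h' <;> simp [sortedPair, h']

namespace IsSymmetricGaussianArray

variable {Ω : Type*} [MeasurableSpace Ω] {n : ℕ} {g : Fin n → Fin n → Ω → ℝ} {P : Measure Ω}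

/-- The bilinear form is a linear combination of the independent entries. The factor 2 arises
because an off-diagonal entry occurs at two positions. -/
theorem hasSubgaussianMGF_inner (hg : IsSymmetricGaussianArray g P) (x y : EuclideanSpace ℝ (Fin n)) :
    ∃ c : NNReal, (c : ℝ) ≤ 2 * (‖x‖ ^ 2 * ‖y‖ ^ 2) ∧ HasSubgaussianMGF (fun ω =>
      inner ℝ y (Matrix.toEuclideanCLM (n := Fin n) (𝕜 := ℝ) (structuredMatrix (fun _ _ => 1) g ω) x))
      c P := by
  let f : {p : Fin n × Fin n // p.1 ≤ p.2} → ℝ := fun a =>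
    ∑ p : Fin n × Fin n with sortedPair p.1 p.2 = a, y p.1 * x p.2
  have hsub := HasSubgaussianMGF.sum_of_iIndepFun (s := univ)
    (X := fun (a : {p : Fin n × Fin n // p.1 ≤ p.2}) ω => f a * g a.1.1 a.1.2 ω)
    (c := fun a => ⟨f a ^ 2, sq_nonneg _⟩ * 1)
    (hg.indep.comp (fun a z => f a * z) fun a => by fun_prop)
    fun a _ => (hasSubgaussianMGF_of_hasLaw_gaussianReal (hg.law _ _)).const_mul (f a)
  refine ⟨_, ?_, hsub.congr (ae_of_all _ fun ω => ?_)⟩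
  · push_cast
    calc ∑ a, f a ^ 2 * 1
        ≤ ∑ a, 2 * ∑ p : Fin n × Fin n with sortedPair p.1 p.2 = a, (y p.1 * x p.2) ^ 2 := by
          refine sum_le_sum fun a _ => ?_
          rw [mul_one]
          refine sq_sum_le_card_mul_sum_sq.trans ?_
          gcongr
          exact_mod_cast card_sortedPair_fiber_le a
      _ = 2 * ∑ p : Fin n × Fin n, (y p.1 * x p.2) ^ 2 := by
          rw [← mul_sum, sum_fiberwise]
      _ = 2 * (‖x‖ ^ 2 * ‖y‖ ^ 2) := by
          rw [EuclideanSpace.real_norm_sq_eq, EuclideanSpace.real_norm_sq_eq, mul_comm (∑ i, x i ^ 2),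
            sum_mul_sum, Fintype.sum_prod_type]
          simp only [mul_pow]
  · simp only [f, sum_mul]
    calc _ = ∑ a, ∑ p : Fin n × Fin n with sortedPair p.1 p.2 = a,
          y p.1 * (x p.2 * g p.1 p.2 ω) := by
          refine sum_congr rfl fun a _ => sum_congr rfl fun p hp => ?_
          rw [hg.eq_sortedPair p.1 p.2, (mem_filter.1 hp).2, mul_assoc]
      _ = ∑ p : Fin n × Fin n, y p.1 * (x p.2 * g p.1 p.2 ω) := sum_fiberwise _ _ _
      _ = _ := by
          rw [Matrix.inner_toEuclideanCLM, Fintype.sum_prod_type]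
          simp only [dotProduct, Matrix.mulVec, mul_sum, structuredMatrix, Matrix.of_apply]
          simp [mul_comm]

/-- Union bound in moment form: the norm is at most the largest of 25^n bilinear forms on net
points, with variance proxy at most 2 · 2² · 2² = 32. -/
theorem integral_norm_pow_le [IsProbabilityMeasure P] (hg : IsSymmetricGaussianArray g P)
    (hn : 0 < n) {p : ℕ} (hp : 0 < p) :
    ∫ ω, ‖structuredMatrix (fun _ _ => 1) g ω‖ ^ (2 * p) ∂P ≤
      25 ^ n * (2 * (2 * Real.exp 1 * 32 * p) ^ p) := by
  obtain ⟨s, hcard, hs2, hs⟩ :=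
    exists_finset_card_le_forall_norm_sub_lt_one (EuclideanSpace ℝ (Fin n))
  rw [finrank_euclideanSpace_fin] at hcard
  let Z : EuclideanSpace ℝ (Fin n) × EuclideanSpace ℝ (Fin n) → Ω → ℝ := fun q ω =>
    inner ℝ q.2 (Matrix.toEuclideanCLM (n := Fin n) (𝕜 := ℝ) (structuredMatrix (fun _ _ => 1) g ω) q.1)
  have hZ : ∀ q ∈ s ×ˢ s, Integrable (fun ω => Z q ω ^ (2 * p)) P ∧
      ∫ ω, Z q ω ^ (2 * p) ∂P ≤ 2 * (2 * Real.exp 1 * 32 * p) ^ p := by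
    intro q hq
    rw [mem_product] at hq
    obtain ⟨c, hc, hsub⟩ := hg.hasSubgaussianMGF_inner q.1 q.2
    refine ⟨hsub.integrable_pow _, hsub.integral_pow_le (by norm_num) (hc.trans ?_) hp⟩
    have h1 := hs2 _ hq.1
    have h2 := hs2 _ hq.2
    calc 2 * (‖q.1‖ ^ 2 * ‖q.2‖ ^ 2) ≤ 2 * (2 ^ 2 * 2 ^ 2) := by gcongr
      _ = 32 := by norm_num
  calc ∫ ω, ‖structuredMatrix (fun _ _ => 1) g ω‖ ^ (2 * p) ∂P
      ≤ ∫ ω, ∑ q ∈ s ×ˢ s, Z q ω ^ (2 * p) ∂P := by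
        refine integral_mono (hg.integrable_norm_pow (fun _ _ => rfl) hn hp)
          (integrable_finsetSum _ fun q hq => (hZ q hq).1) fun ω => ?_
        obtain ⟨c, hc, d, hd, h⟩ := exists_opNorm_le_inner_of_net hs
          (Matrix.toEuclideanCLM (n := Fin n) (𝕜 := ℝ) (structuredMatrix (fun _ _ => 1) g ω))
        rw [Matrix.l2_opNorm_toEuclideanCLM] at h
        have hcd : (c, d) ∈ s ×ˢ s := mem_product.2 ⟨hc, hd⟩
        have h' : ‖structuredMatrix (fun _ _ => 1) g ω‖ ≤ Z (c, d) ω := h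
        have h2 : ‖structuredMatrix (fun _ _ => 1) g ω‖ ^ (2 * p) ≤ Z (c, d) ω ^ (2 * p) :=
          pow_le_pow_left₀ (norm_nonneg _) h' _
        have h3 : Z (c, d) ω ^ (2 * p) ≤ ∑ q ∈ s ×ˢ s, Z q ω ^ (2 * p) :=
          single_le_sum (f := fun q => Z q ω ^ (2 * p))
            (fun q _ => (even_two_mul p).pow_nonneg _) hcd
        exact h2.trans h3
    _ = ∑ q ∈ s ×ˢ s, ∫ ω, Z q ω ^ (2 * p) ∂P := integral_finsetSum _ fun q hq => (hZ q hq).1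
    _ ≤ ∑ q ∈ s ×ˢ s, 2 * (2 * Real.exp 1 * 32 * p) ^ p := sum_le_sum fun q hq => (hZ q hq).2
    _ = (#s * #s : ℕ) * (2 * (2 * Real.exp 1 * 32 * p) ^ p) := by
        rw [sum_const, card_product, nsmul_eq_mul]
    _ ≤ 25 ^ n * (2 * (2 * Real.exp 1 * 32 * p) ^ p) := by
        gcongr
        calc ((#s * #s : ℕ) : ℝ) ≤ ((5 ^ n * 5 ^ n : ℕ) : ℝ) := by exact_mod_cast Nat.mul_le_mul hcard hcard
          _ = 25 ^ n := by push_cast; rw [← mul_pow]; norm_num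

end IsSymmetricGaussianArray

theorem exists_isSymmetricGaussianArray (r : ℕ) :
    ∃ (g : Fin r → Fin r → ({p : Fin r × Fin r // p.1 ≤ p.2} → ℝ) → ℝ),
      IsSymmetricGaussianArray g (Measure.pi fun _ => gaussianReal 0 1) := by
  refine ⟨fun i j ω => ω (sortedPair i j), fun i j => ?_, fun i j => ?_, ?_⟩
  · have : sortedPair i j = sortedPair j i := by simp [sortedPair_eq_iff]
    rw [this]
  · exact (measurePreserving_eval (fun _ => gaussianReal 0 1) (sortedPair i j)).hasLaw
  · have h := iIndepFun_pi (μ := fun _ : {p : Fin r × Fin r // p.1 ≤ p.2} => gaussianReal 0 1)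
      (X := fun _ x => x) fun _ => aemeasurable_id
    convert h using 4 with a
    simp [sortedPair, a.2]

/-! ### Lower bounds from one entry and from one row -/

theorem gaussianMoment_two : gaussianMoment 2 = 1 := by
  have h := variance_fun_id_gaussianReal (μ := 0) (v := 1)
  rw [variance_of_integral_eq_zero (by fun_prop) integral_id_gaussianReal] at h
  simpa [gaussianMoment] using h

theorem exp_div_sqrt_le_gaussianReal_Icc {q : ℝ} (hq : 0 ≤ q) :
    Real.exp (-(q + 1)) / √(2 * Real.pi) ≤ (gaussianReal 0 1).real (Set.Icc √q (√q + 1)) := by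
  rw [measureReal_def, gaussianReal_apply_eq_integral 0 one_ne_zero,
    ENNReal.toReal_ofReal (integral_nonneg fun x => gaussianPDFReal_nonneg _ _ _)]
  have h := setIntegral_ge_of_const_le_real (μ := volume) (s := Set.Icc √q (√q + 1))
    (f := gaussianPDFReal 0 1) (c := Real.exp (-(q + 1)) / √(2 * Real.pi)) measurableSet_Icc
    (by simp) (fun x hx => ?_) (integrable_gaussianPDFReal 0 1).integrableOn
  · simpa using h
  · have h0 : 0 ≤ √q := Real.sqrt_nonneg q
    have h1 : √q ^ 2 = q := Real.sq_sqrt hq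
    have h2 : x ^ 2 ≤ (√q + 1) ^ 2 := pow_le_pow_left₀ (h0.trans hx.1) hx.2 2
    rw [gaussianPDFReal_def]
    simp only [NNReal.coe_one, mul_one, sub_zero]
    rw [div_eq_inv_mul]
    gcongr
    nlinarith [sq_nonneg (√q - 1)]

/-- Taking the q-th root of a constant probability κ costs a factor bounded uniformly over q ≥ log
2. -/
theorem mul_rpow_le_rpow_of_rpow_mul_le {a κ q I : ℝ} (ha : 0 ≤ a) (hκ : 0 < κ) (hκ1 : κ ≤ 1)
    (hq : Real.log 2 ≤ q) (h : a ^ q * κ ≤ I) : a * κ ^ (1 / Real.log 2) ≤ I ^ (1 / q) := by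
  have hl : 0 < Real.log 2 := Real.log_pos one_lt_two
  have hq0 : 0 < q := hl.trans_le hq
  calc a * κ ^ (1 / Real.log 2) ≤ a * κ ^ (1 / q) := by
        gcongr a * ?_
        exact Real.rpow_le_rpow_of_exponent_ge hκ hκ1 (one_div_le_one_div_of_le hl hq)
    _ = (a ^ q * κ) ^ (1 / q) := by
        rw [Real.mul_rpow (by positivity) hκ.le, one_div, Real.rpow_rpow_inv ha hq0.ne']
    _ ≤ I ^ (1 / q) := by gcongr

/-- A pointwise form of the Paley–Zygmund inequality: the factor multiplying (σ/√2)^q lies below the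
indicator of S ≥ σ²/2 and is linear in S and T, so it can be integrated directly. It also covers q <
2, where Jensen's inequality would not suffice. -/
theorem rpow_mul_le_sqrt_rpow {S σ K T q : ℝ} (hσ : 0 < σ) (hK : 0 < K)
    (hq : 0 < q) (hT : S ^ 2 ≤ σ ^ 2 * T) :
    (σ / √2) ^ q * ((S / σ ^ 2 - 1 / 2 - T / σ ^ 2 / (4 * K)) / K) ≤ √S ^ q := by
  set w := S / σ ^ 2 with hw
  have hSw : S = w * σ ^ 2 := by rw [hw]; field_simp
  have hTw : w ^ 2 ≤ T / σ ^ 2 := by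
    rw [hw, div_pow, div_le_div_iff₀ (by positivity) (by positivity)]
    nlinarith [sq_nonneg σ]
  have hw2 : w ^ 2 / (4 * K) ≤ T / σ ^ 2 / (4 * K) := by gcongr
  rcases le_total w (1 / 2) with hle | hge
  · refine le_trans (mul_nonpos_of_nonneg_of_nonpos (by positivity) ?_) (by positivity)
    refine div_nonpos_of_nonpos_of_nonneg ?_ hK.le
    have : 0 ≤ w ^ 2 / (4 * K) := by positivity
    linarith
  · have h1 : (w - 1 / 2 - T / σ ^ 2 / (4 * K)) / K ≤ 1 := by
      rw [div_le_one hK]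
      -- Equivalent to (w - 2K)² ≥ 0.
      have h2 : w - w ^ 2 / (4 * K) ≤ K := by
        rw [sub_le_iff_le_add, ← sub_le_iff_le_add', le_div_iff₀ (by positivity)]
        nlinarith [sq_nonneg (w - 2 * K)]
      linarith
    refine (mul_le_of_le_one_right (by positivity) h1).trans ?_
    refine Real.rpow_le_rpow (by positivity) ?_ hq.le
    refine Real.le_sqrt_of_sq_le ?_
    rw [div_pow, Real.sq_sqrt zero_le_two, hSw]
    nlinarith [sq_nonneg σ]

namespace IsSymmetricGaussianArray

variable {Ω : Type*} [MeasurableSpace Ω] {n : ℕ} {g : Fin n → Fin n → Ω → ℝ} {P : Measure Ω}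
  [IsProbabilityMeasure P] {b : Fin n → Fin n → ℝ} {q : ℝ}

/-- Restrict to the event that the entry's Gaussian lies in [√q, √q + 1]. The e^(-q) in its
probability becomes the factor e^(-1) after the q-th root. -/
theorem entry_mul_sqrt_le (hg : IsSymmetricGaussianArray g P) (hb : ∀ i j, 0 ≤ b i j)
    (hq : Real.log 2 ≤ q) (hint : Integrable (fun ω => ‖structuredMatrix b g ω‖ ^ q) P)
    (i j : Fin n) :
    (Real.exp (-1) * (Real.exp (-1) / √(2 * Real.pi)) ^ (1 / Real.log 2)) * (b i j * √q) ≤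
      (∫ ω, ‖structuredMatrix b g ω‖ ^ q ∂P) ^ (1 / q) := by
  have hq0 : 0 < q := (Real.log_pos one_lt_two).trans_le hq
  set s := Set.Icc √q (√q + 1) with hs
  have hb0 := hb i j
  have hset : NullMeasurableSet {ω | g i j ω ∈ s} P :=
    (hg.law i j).aemeasurable.nullMeasurableSet_preimage measurableSet_Icc
  have hmono : ∫ ω, Set.indicator {ω | g i j ω ∈ s} (fun _ => (b i j * √q) ^ q) ω ∂P ≤
      ∫ ω, ‖structuredMatrix b g ω‖ ^ q ∂P := by
    refine integral_mono ((integrable_const _).indicator₀ hset) hint fun ω => ?_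
    by_cases hω : ω ∈ {ω | g i j ω ∈ s}
    · rw [Set.indicator_of_mem hω]
      refine Real.rpow_le_rpow (by positivity) ?_ hq0.le
      refine le_trans ?_ (Matrix.abs_entry_le_norm _ i j)
      refine le_trans ?_ (le_abs_self _)
      simp only [structuredMatrix, Matrix.of_apply]
      exact mul_le_mul_of_nonneg_left hω.1 hb0
    · rw [Set.indicator_of_notMem hω]
      positivity
  rw [integral_indicator₀ hset, setIntegral_const, smul_eq_mul,
    (hg.law i j).measureReal_eq (p := fun x => x ∈ s) measurableSet_Icc] at hmono
  have hlow := exp_div_sqrt_le_gaussianReal_Icc hq0.le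
  have hκ1 : Real.exp (-1) / √(2 * Real.pi) ≤ 1 := by
    rw [div_le_one (by positivity)]
    refine (Real.exp_le_one_iff.2 (by norm_num)).trans ?_
    rw [Real.one_le_sqrt]
    linarith [Real.pi_gt_three]
  have h := mul_rpow_le_rpow_of_rpow_mul_le (a := Real.exp (-1) * (b i j * √q)) (by positivity)
    (by positivity : 0 < Real.exp (-1) / √(2 * Real.pi)) hκ1 hq (hmono.trans' ?_)
  · refine le_trans (le_of_eq ?_) h
    ring
  · calc _ = Real.exp (-(q + 1)) / √(2 * Real.pi) * (b i j * √q) ^ q := by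
          rw [Real.mul_rpow (by positivity) (by positivity), ← Real.exp_mul, neg_add, Real.exp_add]
          ring_nf
      _ ≤ _ := by
          gcongr
          exact hlow

theorem integrable_pow (hg : IsSymmetricGaussianArray g P) (i j : Fin n) (m : ℕ) :
    Integrable (fun ω => g i j ω ^ m) P :=
  (hasSubgaussianMGF_of_hasLaw_gaussianReal (hg.law i j)).integrable_pow m

theorem sqrt_sum_sq_row_le (hg : IsSymmetricGaussianArray g P)
    (hq : Real.log 2 ≤ q) (hint : Integrable (fun ω => ‖structuredMatrix b g ω‖ ^ q) P)
    (i : Fin n) :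
    ((1 / (4 * (gaussianMoment 4 + 1))) ^ (1 / Real.log 2) / √2) * √(∑ j, b i j ^ 2) ≤
      (∫ ω, ‖structuredMatrix b g ω‖ ^ q ∂P) ^ (1 / q) := by
  have hq0 : 0 < q := (Real.log_pos one_lt_two).trans_le hq
  have hm4 := gaussianMoment_nonneg 4
  -- With this K the integrated minorant is at least (1 - 1/2 - 1/4)/K = 1/(4K), so the value of the
  -- fourth moment is not needed.
  set K := gaussianMoment 4 + 1 with hK
  have hK0 : 0 < K := by positivity
  set σ := √(∑ j, b i j ^ 2) with hσ
  rcases (Real.sqrt_nonneg (∑ j, b i j ^ 2)).eq_or_lt with h0 | hσ0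
  · rw [hσ, ← h0, mul_zero]
    exact Real.rpow_nonneg (integral_nonneg fun ω => by positivity) _
  rw [← hσ] at hσ0
  have hσ2 : σ ^ 2 = ∑ j, b i j ^ 2 := Real.sq_sqrt (sum_nonneg fun j _ => sq_nonneg _)
  have hS : ∀ ω, √(∑ j, b i j ^ 2 * g i j ω ^ 2) ≤ ‖structuredMatrix b g ω‖ := by
    intro ω
    refine le_trans (le_of_eq ?_) (Matrix.sqrt_sum_sq_row_le_norm _ i)
    simp [structuredMatrix, mul_pow]
  have hi2 : Integrable (fun ω => ∑ j, b i j ^ 2 * g i j ω ^ 2) P :=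
    integrable_finsetSum _ fun j _ => (hg.integrable_pow i j 2).const_mul _
  have hi4 : Integrable (fun ω => ∑ j, b i j ^ 2 * g i j ω ^ 4) P :=
    integrable_finsetSum _ fun j _ => (hg.integrable_pow i j 4).const_mul _
  have he2 : ∫ ω, ∑ j, b i j ^ 2 * g i j ω ^ 2 ∂P = σ ^ 2 := by
    rw [integral_finsetSum _ fun j _ => (hg.integrable_pow i j 2).const_mul _, hσ2]
    simp only [integral_const_mul, hg.integral_pow, gaussianMoment_two, mul_one]
  have he4 : ∫ ω, ∑ j, b i j ^ 2 * g i j ω ^ 4 ∂P = σ ^ 2 * gaussianMoment 4 := by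
    rw [integral_finsetSum _ fun j _ => (hg.integrable_pow i j 4).const_mul _, hσ2, sum_mul]
    simp only [integral_const_mul, hg.integral_pow]
  have hmono : ∫ ω, (σ / √2) ^ q * (((∑ j, b i j ^ 2 * g i j ω ^ 2) / σ ^ 2 - 1 / 2 -
      (∑ j, b i j ^ 2 * g i j ω ^ 4) / σ ^ 2 / (4 * K)) / K) ∂P ≤
      ∫ ω, ‖structuredMatrix b g ω‖ ^ q ∂P := by
    refine integral_mono (((((hi2.div_const _).sub (integrable_const _)).sub
      ((hi4.div_const _).div_const _)).div_const _).const_mul _) hint fun ω => ?_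
    refine (rpow_mul_le_sqrt_rpow hσ0 hK0 hq0 ?_).trans
      (Real.rpow_le_rpow (Real.sqrt_nonneg _) (hS ω) hq0.le)
    rw [hσ2]
    calc (∑ j, b i j ^ 2 * g i j ω ^ 2) ^ 2 = (∑ j, b i j * (b i j * g i j ω ^ 2)) ^ 2 := by
          congr 1
          exact sum_congr rfl fun j _ => by ring
      _ ≤ (∑ j, b i j ^ 2) * ∑ j, (b i j * g i j ω ^ 2) ^ 2 := sum_mul_sq_le_sq_mul_sq _ _ _
      _ = _ := by
          congr 1
          exact sum_congr rfl fun j _ => by ring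
  have hi3 : Integrable (fun ω => (∑ j, b i j ^ 2 * g i j ω ^ 2) / σ ^ 2 - 1 / 2) P :=
    (hi2.div_const _).sub (integrable_const _)
  rw [integral_const_mul, integral_div, integral_sub hi3
      ((hi4.div_const _).div_const _), integral_sub (hi2.div_const _) (integrable_const _)] at hmono
  simp only [integral_div, he2, he4, integral_const, probReal_univ, one_smul] at hmono
  rw [div_self (by positivity), mul_div_cancel_left₀ _ (by positivity)] at hmono
  have hκ1 : 1 / (4 * K) ≤ 1 := by
    rw [div_le_one (by positivity)]
    linarith
  have h := mul_rpow_le_rpow_of_rpow_mul_le (a := σ / √2) (by positivity)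
    (by positivity : 0 < 1 / (4 * K)) hκ1 hq (hmono.trans' ?_)
  · refine le_trans (le_of_eq ?_) h
    ring
  · have h4 : gaussianMoment 4 / (4 * K) ≤ 1 / 4 := by
      rw [div_le_div_iff₀ (by positivity) (by norm_num)]
      linarith
    refine mul_le_mul_of_nonneg_left ?_ (by positivity)
    rw [← div_div]
    exact div_le_div_of_nonneg_right (by linarith) hK0.le

end IsSymmetricGaussianArray

/-! ### Upper bound and conclusion -/

theorem sqrt_sum_sq_le_maxRowNorm {n : ℕ} (b : Fin n → Fin n → ℝ) (i : Fin n) :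
    √(∑ j, b i j ^ 2) ≤ maxRowNorm b :=
  le_ciSup (f := fun i => √(∑ j, b i j ^ 2)) (Set.finite_range _).bddAbove i

theorem le_maxEntry {n : ℕ} (b : Fin n → Fin n → ℝ) (i j : Fin n) : b i j ≤ maxEntry b :=
  le_ciSup (f := fun p : Fin n × Fin n => b p.1 p.2) (Set.finite_range _).bddAbove (i, j)

theorem exists_eq_maxRowNorm {n : ℕ} (hn : 0 < n) (b : Fin n → Fin n → ℝ) :
    ∃ i, √(∑ j, b i j ^ 2) = maxRowNorm b :=
  have : Nonempty (Fin n) := ⟨⟨0, hn⟩⟩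
  exists_eq_ciSup_of_finite

theorem exists_eq_maxEntry {n : ℕ} (hn : 0 < n) (b : Fin n → Fin n → ℝ) :
    ∃ i j, b i j = maxEntry b := by
  have : Nonempty (Fin n) := ⟨⟨0, hn⟩⟩
  obtain ⟨p, hp⟩ := exists_eq_ciSup_of_finite (f := fun p : Fin n × Fin n => b p.1 p.2)
  exact ⟨p.1, p.2, hp⟩

theorem maxEntry_le_maxRowNorm {n : ℕ} (hn : 0 < n) (b : Fin n → Fin n → ℝ) :
    maxEntry b ≤ maxRowNorm b := by
  obtain ⟨i, j, h⟩ := exists_eq_maxEntry hn b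
  rw [← h]
  refine le_trans (Real.le_sqrt_of_sq_le ?_) (sqrt_sum_sq_le_maxRowNorm b i)
  exact single_le_sum (f := fun j => b i j ^ 2) (fun j _ => sq_nonneg _) (mem_univ j)

/-- Integrate u^q ≤ 1 + u^N at u = Z/M; this yields integrability as well as the bound for real
exponents q ≤ N. -/
theorem integral_rpow_le_two_mul_rpow {Ω : Type*} [MeasurableSpace Ω] {P : Measure Ω}
    [IsProbabilityMeasure P] {Z : Ω → ℝ} (hZ0 : ∀ ω, 0 ≤ Z ω) (hZ : AEMeasurable Z P) {q M : ℝ}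
    {N : ℕ} (hq : 0 ≤ q) (hqN : q ≤ N) (hM : 0 < M) (hint : Integrable (fun ω => Z ω ^ N) P)
    (hle : ∫ ω, Z ω ^ N ∂P ≤ M ^ N) :
    Integrable (fun ω => Z ω ^ q) P ∧ ∫ ω, Z ω ^ q ∂P ≤ 2 * M ^ q := by
  have hpt : ∀ ω, Z ω ^ q ≤ M ^ q * (1 + Z ω ^ N / M ^ N) := by
    intro ω
    have h : (Z ω / M) ^ q ≤ 1 + (Z ω / M) ^ N := by
      have h0 : 0 ≤ Z ω / M := div_nonneg (hZ0 ω) hM.le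
      rcases le_total (Z ω / M) 1 with h1 | h1
      · exact (Real.rpow_le_one h0 h1 hq).trans (le_add_of_nonneg_right (by positivity))
      · refine (Real.rpow_le_rpow_of_exponent_le h1 hqN).trans ?_
        rw [Real.rpow_natCast]
        linarith
    rwa [Real.div_rpow (hZ0 ω) hM.le, div_pow, div_le_iff₀' (by positivity)] at h
  have hi : Integrable (fun ω => M ^ q * (1 + Z ω ^ N / M ^ N)) P :=
    ((integrable_const _).add (hint.div_const _)).const_mul _
  have hi' : Integrable (fun ω => Z ω ^ q) P := by
    refine hi.mono' (hZ.pow_const q).aestronglyMeasurable (ae_of_all _ fun ω => ?_)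
    rw [Real.norm_eq_abs, abs_of_nonneg (Real.rpow_nonneg (hZ0 ω) _)]
    exact hpt ω
  refine ⟨hi', (integral_mono hi' hi hpt).trans ?_⟩
  rw [integral_const_mul, integral_add (integrable_const _) (hint.div_const _), integral_div,
    integral_const, probReal_univ, one_smul, mul_comm]
  gcongr
  have := (div_le_one (by positivity)).2 hle
  linarith

namespace IsSymmetricGaussianArray

variable {Ω : Type*} [MeasurableSpace Ω] {n : ℕ} {g : Fin n → Fin n → Ω → ℝ} {P : Measure Ω}
  [IsProbabilityMeasure P] {b : Fin n → Fin n → ℝ}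

/-- Passing from norm to trace for X is free; passing back for Y costs its dimension 2p, which
cancels the 2p in `mul_sum_closed_walks_le`. -/
theorem integral_norm_structuredMatrix_pow_le (hg : IsSymmetricGaussianArray g P) {p : ℕ}
    (hn : 0 < n) (hp : 0 < p)
    (hb0 : ∀ i j, 0 ≤ b i j) (hb1 : ∀ i j, b i j ≤ 1) (hbs : ∀ i j, b i j = b j i)
    (hbp : ∀ i, ∑ j, b i j ^ 2 ≤ p) :
    ∫ ω, ‖structuredMatrix b g ω‖ ^ (2 * p) ∂P ≤
      n * (25 ^ (2 * p) * (2 * (2 * Real.exp 1 * 32 * p) ^ p)) := by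
  obtain ⟨g', hg'⟩ := exists_isSymmetricGaussianArray (2 * p)
  have hp2 : 0 < 2 * p := by omega
  have hp2' : (0 : ℝ) < (2 * p : ℕ) := by exact_mod_cast hp2
  have hX : ∫ ω, ‖structuredMatrix b g ω‖ ^ (2 * p) ∂P ≤
      ∫ ω, (structuredMatrix b g ω ^ (2 * p)).trace ∂P :=
    integral_mono (hg.integrable_norm_pow hbs hn hp) (hg.integrable_trace_pow b hp2)
      fun ω => Matrix.norm_pow_le_trace_pow hn (hg.isHermitian hbs ω)
  have hY : ∫ ω, (structuredMatrix (fun _ _ => 1) g' ω ^ (2 * p)).trace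
      ∂(Measure.pi fun _ => gaussianReal 0 1) ≤
      (2 * p : ℕ) * (25 ^ (2 * p) * (2 * (2 * Real.exp 1 * 32 * p) ^ p)) := by
    refine le_trans (integral_mono (hg'.integrable_trace_pow _ hp2)
      ((hg'.integrable_norm_pow (fun _ _ => rfl) hp2 hp).const_mul ((2 * p : ℕ) : ℝ))
      fun ω => Matrix.trace_pow_le hp2 _) ?_
    rw [integral_const_mul]
    exact mul_le_mul_of_nonneg_left (hg'.integral_norm_pow_le hp2 hp) hp2'.le
  have hcmp := mul_sum_closed_walks_le hb0 hb1 hbs hbp gaussianMoment_zero gaussianMoment_one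
    gaussianMoment_nonneg
  rw [hg'.integral_trace_pow _ hp2] at hY
  rw [hg.integral_trace_pow _ hp2] at hX
  simp only [prod_const_one, one_mul] at hY
  refine le_of_mul_le_mul_left ?_ hp2'
  refine (mul_le_mul_of_nonneg_left hX hp2'.le).trans (hcmp.trans ?_)
  refine (mul_le_mul_of_nonneg_left hY (Nat.cast_nonneg n)).trans (le_of_eq ?_)
  ring

theorem integrable_and_integral_rpow_le (hg : IsSymmetricGaussianArray g P) (hn : 2 ≤ n)
    (hb : ∀ i j, 0 ≤ b i j) (hbs : ∀ i j, b i j = b j i) (hB : 0 < maxEntry b) :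
    Integrable (fun ω => ‖structuredMatrix b g ω‖ ^ Real.log n) P ∧
      (∫ ω, ‖structuredMatrix b g ω‖ ^ Real.log n ∂P) ^ (1 / Real.log n) ≤
        (2 ^ (1 / Real.log 2) * √(80000 * Real.exp 1 ^ 2) * 2) *
          (maxRowNorm b + maxEntry b * √(Real.log n)) := by
  have hn0 : 0 < n := by omega
  have hn' : (0 : ℝ) < n := Nat.cast_pos.2 hn0
  have hl2 : 0 < Real.log 2 := Real.log_pos one_lt_two
  have hq2 : Real.log 2 ≤ Real.log n := Real.log_le_log two_pos (by exact_mod_cast hn)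
  have hq : 0 < Real.log n := hl2.trans_le hq2
  have hBs := maxEntry_le_maxRowNorm hn0 b
  have hrow := sqrt_sum_sq_le_maxRowNorm b
  have hent := le_maxEntry b
  set B := maxEntry b with hBdef
  set s := maxRowNorm b with hsdef
  set q := Real.log n with hqdef
  -- The first summand meets the row condition after division by B, the second gives n ≤ e^p.
  set p : ℕ := ⌈s ^ 2 / B ^ 2⌉₊ + ⌈q⌉₊ with hp
  have hps : s ^ 2 / B ^ 2 ≤ p := by
    rw [hp, Nat.cast_add]
    exact (Nat.le_ceil _).trans (le_add_of_nonneg_right (Nat.cast_nonneg _))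
  have hpq : q ≤ p := by
    rw [hp, Nat.cast_add]
    exact (Nat.le_ceil _).trans (le_add_of_nonneg_left (Nat.cast_nonneg _))
  have hp0 : 0 < p := Nat.cast_pos.1 (hq.trans_le hpq)
  have hp0' : (0 : ℝ) < p := Nat.cast_pos.2 hp0
  -- The two roundings cost 2B², absorbed using B ≤ s.
  have hpu : B ^ 2 * p ≤ 3 * s ^ 2 + B ^ 2 * q := by
    have h1 : (p : ℝ) ≤ (s ^ 2 / B ^ 2 + 1) + (q + 1) := by
      rw [hp, Nat.cast_add]
      exact add_le_add (Nat.ceil_lt_add_one (by positivity)).le (Nat.ceil_lt_add_one hq.le).le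
    have h2 : B ^ 2 * (s ^ 2 / B ^ 2) = s ^ 2 := by field_simp
    have h3 : B ^ 2 ≤ s ^ 2 := by gcongr
    nlinarith [mul_le_mul_of_nonneg_left h1 (sq_nonneg B)]
  have hX' : ∀ ω, structuredMatrix b g ω = B • structuredMatrix (fun i j => b i j / B) g ω := by
    intro ω
    ext i j
    simp only [structuredMatrix, Matrix.of_apply, Matrix.smul_apply, smul_eq_mul]
    field_simp
  have hmom : ∫ ω, ‖structuredMatrix b g ω‖ ^ (2 * p) ∂P ≤
      (√(80000 * Real.exp 1 ^ 2) * √(B ^ 2 * p)) ^ (2 * p) := by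
    simp only [hX', norm_smul, mul_pow, Real.norm_eq_abs, abs_of_pos hB]
    rw [integral_const_mul]
    have h := hg.integral_norm_structuredMatrix_pow_le (b := fun i j => b i j / B) hn0 hp0
      (fun i j => div_nonneg (hb i j) hB.le) (fun i j => (div_le_one hB).2 (hent i j))
      (fun i j => by rw [hbs]) (fun i => ?_)
    · have hne : (n : ℝ) ≤ Real.exp 1 ^ p := by
        rw [Real.exp_one_pow, ← Real.log_le_iff_le_exp hn']
        exact hpq
      have h2p : (2 : ℝ) ≤ 2 ^ p := le_self_pow₀ one_le_two hp0.ne'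
      -- Per power of p the constants are e · 25² · 2 · (2e · 32) = 80000 e².
      calc B ^ (2 * p) * _ ≤ B ^ (2 * p) *
            (n * (25 ^ (2 * p) * (2 * (2 * Real.exp 1 * 32 * p) ^ p))) := by gcongr
        _ ≤ B ^ (2 * p) * (Real.exp 1 ^ p * (25 ^ (2 * p) *
            (2 ^ p * (2 * Real.exp 1 * 32 * p) ^ p))) := by gcongr
        _ = _ := by
            rw [pow_mul √(80000 * _), pow_mul √(B ^ 2 * _), Real.sq_sqrt (by positivity),
              Real.sq_sqrt (by positivity), pow_mul B, pow_mul (25 : ℝ)]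
            simp only [← mul_pow]
            congr 1
            ring
    · simp only [div_pow]
      rw [← sum_div]
      refine le_trans ?_ hps
      gcongr
      exact (Real.sqrt_le_left (hB.le.trans hBs)).1 (hrow i)
  set M := √(80000 * Real.exp 1 ^ 2) * √(B ^ 2 * p) with hM
  have hM0 : 0 < M := by positivity
  have hqN : q ≤ (2 * p : ℕ) := by
    push_cast
    linarith
  obtain ⟨hint, hle⟩ := integral_rpow_le_two_mul_rpow (fun ω => norm_nonneg _)
    (hg.aemeasurable_norm b) hq.le hqN hM0 (hg.integrable_norm_pow hbs hn0 hp0) hmom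
  refine ⟨hint, ?_⟩
  have hroot : √(B ^ 2 * p) ≤ 2 * (s + B * √q) := by
    have hsq : √q ^ 2 = q := Real.sq_sqrt hq.le
    have hs0 : 0 < s := hB.trans_le hBs
    have hcross : 0 ≤ s * (B * √q) := by positivity
    refine Real.sqrt_le_iff.2 ⟨by positivity, hpu.trans ?_⟩
    nlinarith [sq_nonneg s, mul_nonneg (sq_nonneg B) hq.le]
  calc (∫ ω, ‖structuredMatrix b g ω‖ ^ q ∂P) ^ (1 / q) ≤ (2 * M ^ q) ^ (1 / q) := by
        have h0 : 0 ≤ ∫ ω, ‖structuredMatrix b g ω‖ ^ q ∂P :=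
          integral_nonneg fun ω => by positivity
        gcongr
    _ = 2 ^ (1 / q) * M := by
        rw [Real.mul_rpow zero_le_two (by positivity), one_div, Real.rpow_rpow_inv hM0.le hq.ne']
    _ ≤ 2 ^ (1 / Real.log 2) * M := by
        gcongr
        exact one_le_two
    _ ≤ 2 ^ (1 / Real.log 2) * (√(80000 * Real.exp 1 ^ 2) * (2 * (s + B * √q))) := by
        rw [hM]
        gcongr
    _ = _ := by ring

end IsSymmetricGaussianArray

end

open scoped Matrix.Norms.L2Operator in
theorem mainTheorem3 :
    ∃ c C : ℝ, 0 < c ∧ 0 < C ∧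
      ∀ (n : ℕ), 2 ≤ n →
      ∀ (b : Fin n → Fin n → ℝ), (∀ i j, 0 ≤ b i j) → (∀ i j, b i j = b j i) →
      ∀ {Ω : Type*} [MeasurableSpace Ω] (P : Measure Ω) [IsProbabilityMeasure P]
        (g : Fin n → Fin n → Ω → ℝ), IsSymmetricGaussianArray g P →
        Integrable (fun ω => matrixSpectralNorm (structuredMatrix b g ω) ^ Real.log n) P ∧
        c * (maxRowNorm b + maxEntry b * √(Real.log n)) ≤
          (∫ ω, matrixSpectralNorm (structuredMatrix b g ω) ^ Real.log n ∂P) ^ (1 / Real.log n) ∧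
        (∫ ω, matrixSpectralNorm (structuredMatrix b g ω) ^ Real.log n ∂P) ^ (1 / Real.log n) ≤
          C * (maxRowNorm b + maxEntry b * √(Real.log n)) := by
  set c₁ : ℝ := Real.exp (-1) * (Real.exp (-1) / √(2 * Real.pi)) ^ (1 / Real.log 2)
  set c₂ : ℝ := (1 / (4 * (gaussianMoment 4 + 1))) ^ (1 / Real.log 2) / √2
  have hm4 := gaussianMoment_nonneg 4
  have hc₁ : 0 < c₁ := by positivity
  have hc₂ : 0 < c₂ := by positivity
  have hc : 0 < min c₁ c₂ := lt_min hc₁ hc₂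
  refine ⟨min c₁ c₂ / 2, 2 ^ (1 / Real.log 2) * √(80000 * Real.exp 1 ^ 2) * 2, by positivity,
    by positivity, ?_⟩
  intro n hn b hb hbs Ω _ P _ g hg
  have hn0 : 0 < n := by omega
  have hq2 : Real.log 2 ≤ Real.log n := Real.log_le_log two_pos (by exact_mod_cast hn)
  have hq : 0 < Real.log n := (Real.log_pos one_lt_two).trans_le hq2
  simp only [matrixSpectralNorm_eq_norm hn0]
  obtain ⟨i₀, j₀, hij⟩ := exists_eq_maxEntry hn0 b
  obtain ⟨i₁, hi⟩ := exists_eq_maxRowNorm hn0 b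
  have hB0 : 0 ≤ maxEntry b := hij ▸ hb i₀ j₀
  have hs0 : 0 ≤ maxRowNorm b := hi ▸ Real.sqrt_nonneg _
  have hupper : Integrable (fun ω => ‖structuredMatrix b g ω‖ ^ Real.log n) P ∧
      (∫ ω, ‖structuredMatrix b g ω‖ ^ Real.log n ∂P) ^ (1 / Real.log n) ≤
        (2 ^ (1 / Real.log 2) * √(80000 * Real.exp 1 ^ 2) * 2) *
          (maxRowNorm b + maxEntry b * √(Real.log n)) := by
    -- Rescaling by the largest entry needs it to be positive; otherwise X vanishes.
    rcases hB0.eq_or_lt with h0 | hB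
    · have hb00 : ∀ i j, b i j = 0 := fun i j =>
        le_antisymm (h0 ▸ le_maxEntry b i j) (hb i j)
      have hX0 : ∀ ω, structuredMatrix b g ω = 0 := fun ω => by
        ext i j
        simp [structuredMatrix, hb00]
      simp only [hX0, norm_zero, Real.zero_rpow hq.ne', integral_zero,
        Real.zero_rpow (one_div_pos.2 hq).ne']
      exact ⟨integrable_zero _ _ _, by positivity⟩
    · exact hg.integrable_and_integral_rpow_le hn hb hbs hB
  refine ⟨hupper.1, ?_, hupper.2⟩
  have h1 := hg.entry_mul_sqrt_le hb hq2 hupper.1 i₀ j₀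
  have h2 := hg.sqrt_sum_sq_row_le hq2 hupper.1 i₁
  rw [hij] at h1
  rw [hi] at h2
  have h1' := (mul_le_mul_of_nonneg_right (min_le_left c₁ c₂)
    (mul_nonneg hB0 (Real.sqrt_nonneg (Real.log n)))).trans h1
  have h2' := (mul_le_mul_of_nonneg_right (min_le_right c₁ c₂) hs0).trans h2
  linarith
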